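/- Let $n,k$ be integers with $\lceil n/2\rceil<k\le n$, let $F$ be a field of characteristic zero, and let $H$ be a diagonal $k$-uniform hypergraph on the vertex set $\{1,\dots,n\}$, i.e. a hypergraph isomorphic to the one with hyperedges $\{i,i+1,\dots,i+k-1\}$ for $1\le i\le n-k+1$. For $r\ge -1$ let $C_r$ be the $F$-vector space spanned by the ordered partitions $(B_1,\dots,B_{r+2})$ of $\{1,\dots,n\}$ into $r+2$ nonempty blocks, at least one of which contains a hyperedge of $H$, modulo the relations $$(B_1,\dots,B_{r+2})=(-1)^{r+1}(B_2,\dots,B_{r+2},B_1).$$ Write $[B_1,\dots,B_{r+2}]$ for the class of $(B_1,\dots,B_{r+2})$. For $r\ge 0$ let $\partial_r:C_r\to C_{r-1}$ be the (well-defined) linear map $$\partial_r[B_1,\dots,B_{r+2}]=\sum_{i=1}^{r+1}(-1)^{i+1}[B_1,\dots,B_i\cup B_{i+1},\dots,B_{r+2}]+(-1)^{r+3}[B_1\cup B_{r+2},B_2,\dots,B_{r+1}],$$ and let $\partial_{-1}=0$. This is the cyclic coloring complex $\Delta(H)$, with homology groups $HC_r(\Delta(H))=\ker\partial_r/\operatorname{im}\partial_{r+1}$.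 Then for every integer $r$ with $0\le r\le n-k-1$, $$\dim_F HC_r(\Delta(H))=(n-k)\binom{n-k-1}{r}+\binom{n-k}{r+1},$$ and $$\dim_F HC_{-1}(\Delta(H))=1.$$ -/

import Mathlib

noncomputable section

namespace CyclicColoring

/-- The hypergraph on the vertex set `{0, …, n - 1}` whose hyperedges are all the runs
`{i, i + 1, …, i + k - 1}` of `k` consecutive vertices (vertices are numbered from `0`). -/
def diagonalHypergraph (n k : ℕ) : Hypergraph (Fin n) where
  vertexSet := Set.univ
  edgeSet := {e | ∃ i : ℕ, i + k ≤ n ∧ e = {v : Fin n | i ≤ (v : ℕ) ∧ (v : ℕ) < i + k}}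
  subset_vertexSet_of_mem_edgeSet' := fun _ _ => Set.subset_univ _

/-- `H` is isomorphic to `diagonalHypergraph n k`. -/
def IsDiagonal {n : ℕ} (H : Hypergraph (Fin n)) (k : ℕ) : Prop :=
  ∃ σ : Equiv.Perm (Fin n), H = (diagonalHypergraph n k).image σ

/-- The ordered partitions `(B_0, …, B_{m-1})` of the vertex set into `m` nonempty blocks at least
one of which contains a hyperedge of `H`. Such a partition is encoded by the surjection that sends
a vertex to the index of its block, so that `B_j` is the fibre over `j`. -/
def OrdPart {n : ℕ} (H : Hypergraph (Fin n)) (m : ℕ) : Type :=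
  {f : Fin n → Fin m // Function.Surjective f ∧ ∃ j : Fin m, ∃ e ∈ H.edgeSet, e ⊆ f ⁻¹' {j}}

/-- Relabelling (and possibly merging) the blocks along a surjection `g` of the index sets:
the new block with index `j` is the union of the old blocks with index in `g ⁻¹ {j}`. -/
def OrdPart.push {n : ℕ} {H : Hypergraph (Fin n)} {m m' : ℕ} (g : Fin m → Fin m')
    (hg : Function.Surjective g) (B : OrdPart H m) : OrdPart H m' :=
  ⟨g ∘ B.1, hg.comp B.2.1, by
    obtain ⟨j, e, he, hej⟩ := B.2.2
    exact ⟨g j, e, he, fun v hv => congrArg g (hej hv)⟩⟩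

theorem OrdPart.push_push {n : ℕ} {H : Hypergraph (Fin n)} {a b b' c : ℕ}
    {g : Fin a → Fin b} {hg : Function.Surjective g}
    {h : Fin b → Fin c} {hh : Function.Surjective h}
    {g' : Fin a → Fin b'} {hg' : Function.Surjective g'}
    {h' : Fin b' → Fin c} {hh' : Function.Surjective h'}
    (hyp : ∀ j, h (g j) = h' (g' j)) (B : OrdPart H a) :
    (B.push g hg).push h hh = (B.push g' hg').push h' hh' :=
  Subtype.ext (funext fun v => hyp (B.1 v))

/-- The index map that merges blocks `i` and `i + 1` and keeps the order of the blocks. -/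
def mergeIdx {p : ℕ} (i : Fin (p + 1)) (j : Fin (p + 2)) : Fin (p + 1) :=
  ⟨if (j : ℕ) ≤ i then j else j - 1, by split_ifs <;> omega⟩

/-- The index map that merges the last block, number `p + 1`, into block `0`. -/
def wrapIdx {p : ℕ} (j : Fin (p + 2)) : Fin (p + 1) :=
  ⟨if (j : ℕ) = p + 1 then 0 else j, by split_ifs <;> omega⟩

/-- The index map of the cyclic shift `(B_0, B_1, …, B_p) ↦ (B_1, …, B_p, B_0)`. -/
def rotIdx {p : ℕ} (j : Fin (p + 1)) : Fin (p + 1) :=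
  ⟨if (j : ℕ) = 0 then p else j - 1, by split_ifs <;> omega⟩

theorem mergeIdx_surjective {p : ℕ} (i : Fin (p + 1)) : Function.Surjective (mergeIdx i) := by
  intro j
  by_cases h : (j : ℕ) ≤ i
  · exact ⟨j.castSucc, Fin.ext (by simp [mergeIdx, h])⟩
  · refine ⟨j.succ, Fin.ext ?_⟩
    simp only [mergeIdx, Fin.val_succ]
    split_ifs <;> omega

theorem wrapIdx_surjective {p : ℕ} : Function.Surjective (wrapIdx (p := p)) := by
  intro j
  refine ⟨j.castSucc, Fin.ext ?_⟩
  simp only [wrapIdx, Fin.val_castSucc]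
  split_ifs <;> omega

theorem rotIdx_surjective {p : ℕ} : Function.Surjective (rotIdx (p := p)) := by
  intro j
  by_cases h : (j : ℕ) = p
  · exact ⟨0, Fin.ext (by simp [rotIdx, h])⟩
  · refine ⟨⟨j + 1, by omega⟩, Fin.ext ?_⟩
    simp [rotIdx]

/-- `(B_0, …, B_{p+1}) ↦ (B_0, …, B_i ∪ B_{i+1}, …, B_{p+1})`. -/
def OrdPart.merge {n : ℕ} {H : Hypergraph (Fin n)} {p : ℕ} (i : Fin (p + 1))
    (B : OrdPart H (p + 2)) : OrdPart H (p + 1) :=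
  B.push (mergeIdx i) (mergeIdx_surjective i)

/-- `(B_0, …, B_{p+1}) ↦ (B_0 ∪ B_{p+1}, B_1, …, B_p)`. -/
def OrdPart.wrap {n : ℕ} {H : Hypergraph (Fin n)} {p : ℕ}
    (B : OrdPart H (p + 2)) : OrdPart H (p + 1) :=
  B.push wrapIdx wrapIdx_surjective

/-- `(B_0, …, B_p) ↦ (B_1, …, B_p, B_0)`. -/
def OrdPart.rot {n : ℕ} {H : Hypergraph (Fin n)} {p : ℕ}
    (B : OrdPart H (p + 1)) : OrdPart H (p + 1) :=
  B.push rotIdx rotIdx_surjective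

section Complex

variable (F : Type*) [Field F] {n : ℕ} (H : Hypergraph (Fin n))

/-- The vector space with basis the ordered partitions into `p + 1` blocks one of which contains a
hyperedge. Its degree as a space of chains is `r = p - 1`, so `p = r + 1` and there are `r + 2`
blocks. -/
abbrev PreChain (p : ℕ) : Type _ := OrdPart H (p + 1) →₀ F

/-- The span of the relations
`(B_0, …, B_p) - (-1) ^ p (B_1, …, B_p, B_0)`, where `p = r + 1`. -/
def cyclicRel (p : ℕ) : Submodule F (PreChain F H p) :=
  Submodule.span F (Set.range fun B : OrdPart H (p + 1) =>
    Finsupp.single B (1 : F) - (-1 : F) ^ p • Finsupp.single B.rot (1 : F))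

/-- The chains of degree `p - 1` of the cyclic coloring complex: formal combinations of ordered
partitions into `p + 1` blocks modulo the signed cyclic shift. -/
abbrev Chain (p : ℕ) : Type _ := PreChain F H p ⧸ cyclicRel F H p

/-- The boundary formula on ordered partitions,
`(B_0, …, B_{p+1}) ↦ ∑_{i=0}^{p} (-1)^i (…, B_i ∪ B_{i+1}, …)
  + (-1)^{p+1} (B_0 ∪ B_{p+1}, B_1, …, B_p)`. -/
def preBoundary (p : ℕ) : PreChain F H (p + 1) →ₗ[F] PreChain F H p :=
  Finsupp.linearCombination F fun B : OrdPart H (p + 2) =>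
    (∑ i : Fin (p + 1), (-1 : F) ^ (i : ℕ) • Finsupp.single (B.merge i) (1 : F))
      + (-1 : F) ^ (p + 1) • Finsupp.single B.wrap (1 : F)

theorem rot_merge_castSucc {p : ℕ} (B : OrdPart H (p + 3)) (i : Fin (p + 1)) :
    B.rot.merge i.castSucc = (B.merge i.succ).rot := by
  refine OrdPart.push_push (fun j => Fin.ext ?_) B
  simp only [mergeIdx, rotIdx, Fin.val_castSucc, Fin.val_succ]
  split_ifs <;> omega

theorem rot_merge_last {p : ℕ} (B : OrdPart H (p + 2)) :
    B.rot.merge (Fin.last p) = B.wrap.rot := by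
  refine OrdPart.push_push (fun j => Fin.ext ?_) B
  simp only [mergeIdx, rotIdx, wrapIdx, Fin.val_last]
  split_ifs <;> omega

theorem wrapIdx_rotIdx {p : ℕ} (j : Fin (p + 2)) : wrapIdx (rotIdx j) = mergeIdx 0 j := by
  refine Fin.ext ?_
  have hj := j.isLt
  by_cases h : (j : ℕ) = 0
  · simp [mergeIdx, rotIdx, wrapIdx, h]
  · have h1 : (j : ℕ) - 1 ≠ p + 1 := by omega
    simp [mergeIdx, rotIdx, wrapIdx, h, h1]

theorem rot_wrap {p : ℕ} (B : OrdPart H (p + 2)) : B.rot.wrap = B.merge 0 :=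
  Subtype.ext (funext fun v => wrapIdx_rotIdx (B.1 v))

/-- The boundary formula respects the signed cyclic shift. -/
theorem cyclicRel_le_comap (p : ℕ) :
    cyclicRel F H (p + 1) ≤ (cyclicRel F H p).comap (preBoundary F H p) := by
  have rel : ∀ B : OrdPart H (p + 1),
      Finsupp.single B (1 : F) - (-1 : F) ^ p • Finsupp.single B.rot (1 : F) ∈ cyclicRel F H p :=
    fun B => Submodule.subset_span ⟨B, rfl⟩
  refine Submodule.span_le.2 ?_
  rintro _ ⟨B, rfl⟩
  simp only [SetLike.mem_coe, Submodule.mem_comap, map_sub, map_smul, preBoundary,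
    Finsupp.linearCombination_single, one_smul]
  rw [rot_wrap]
  cases p with
  | zero =>
    have h := rel B.wrap
    have h0 : B.rot.merge 0 = B.wrap.rot := rot_merge_last H B
    simp only [Fin.sum_univ_succ, Finset.univ_eq_empty, Finset.sum_empty, Fin.val_zero, h0]
    convert Submodule.neg_mem _ h using 1
    simp
    abel
  | succ q =>
    rw [Fin.sum_univ_succ, Fin.sum_univ_castSucc (n := q + 1)]
    simp only [rot_merge_castSucc, rot_merge_last]
    have h := Submodule.add_mem _
      (Submodule.sum_mem (t := Finset.univ) _ fun (i : Fin (q + 1)) _ =>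
        Submodule.smul_mem _ ((-1 : F) ^ ((i : ℕ) + 1)) (rel (B.merge i.succ)))
      (Submodule.smul_mem _ ((-1 : F) ^ (q + 2)) (rel B.wrap))
    convert h using 1
    have sq : ∀ a : ℕ, (-1 : F) ^ a * (-1 : F) ^ a = 1 := fun a => by
      rw [← mul_pow]; simp
    simp only [smul_sub, smul_add, Finset.smul_sum, smul_smul, Finset.sum_sub_distrib,
      Fin.val_succ, Fin.val_castSucc, Fin.val_last, Fin.val_zero, pow_zero, one_smul, sq]
    have e1 : ∀ i : Fin (q + 1), (-1 : F) ^ ((i : ℕ) + 1) * (-1 : F) ^ (q + 1)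
        = (-1 : F) ^ (q + 1 + 1) * (-1 : F) ^ (i : ℕ) := fun i => by ring
    simp only [e1]
    abel

/-- The boundary map from the chains of degree `p` to the chains of degree `p - 1`. -/
def boundary (p : ℕ) : Chain F H (p + 1) →ₗ[F] Chain F H p :=
  Submodule.mapQ _ _ (preBoundary F H p) (cyclicRel_le_comap F H p)

/-- The cycles of degree `p - 1`; the boundary map out of degree `-1` is zero. -/
def cycles : (p : ℕ) → Submodule F (Chain F H p)
  | 0 => ⊤
  | p + 1 => LinearMap.ker (boundary F H p)

/-- The homology group `HC_{p-1}` of the cyclic coloring complex of `H` over `F`: cycles of degree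
`p - 1` modulo boundaries of chains of degree `p`. -/
abbrev HC (p : ℕ) : Type _ :=
  cycles F H p ⧸ (LinearMap.range (boundary F H p)).submoduleOf (cycles F H p)

end Complex

end CyclicColoring

end

/-! Since `n < 2 * k`, all hyperedges share a vertex `c`. Rotate each cyclic ordered partition so
that the block of `c` comes first, and forget that block. What remains is a word of nonempty
disjoint sets. A block containing a hyperedge must contain `c`, so the remaining letters miss that
hyperedge; conversely every word whose union misses a hyperedge arises. Thus the cyclic coloring
complex is the complex of words over the simplicial complex `Δ` of vertex sets that miss a hyperedge
(`toWords_injective`, `range_toWords`). Merging with the block of `c` becomes dropping the first or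
the last letter (`toWords_boundary`).

For any simplicial complex `Δ` on finitely many vertices, the homology of words with `p` letters has
dimension the number of faces with `p` elements (`finrank_homology`). This goes by induction on
vertices. For a vertex `x`, the inclusion of the deletion and the signed insertion `shuffle x` from
the link identify the homology of `Δ` with the sum of that of the deletion and that of the link,
shifted by one letter. The maps back are `remove x` and `cut x`, and `split x` is the homotopy:
`bdry ∘ split x + split x ∘ bdry = remove x + shuffle x ∘ cut x - id` (`bdry_split`). Face numbers
obey the same recursion.

It remains to count the `(r + 1)`-element sets missing a run of length `k`. Those with nothing to
the left of the run lie in the last `n - k` vertices. Otherwise the greatest element `a` to the left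
of the run takes one of `n - k` values, and the other `r` elements avoid the `k + 1` vertices from
`a` to `a + k`. -/

noncomputable section

namespace CyclicColoring

/-! ### Words in finite sets and their boundary map. -/

namespace Words

variable {F : Type*} [Field F] {V : Type*}

/-- The basis vector of the space of formal combinations of words in finite sets. -/
def word (F : Type*) [Field F] {V : Type*} (w : List (Finset V)) : List (Finset V) →₀ F :=
  Finsupp.single w 1

/-- The linear extension of a function on words. -/
def lin (φ : List (Finset V) → (List (Finset V) →₀ F)) :
    (List (Finset V) →₀ F) →ₗ[F] (List (Finset V) →₀ F) :=
  Finsupp.linearCombination F φ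

@[simp]
theorem lin_word (φ : List (Finset V) → (List (Finset V) →₀ F)) (w : List (Finset V)) :
    lin φ (word F w) = φ w := by
  simp [lin, word]

theorem linearMap_ext {M : Type*} [AddCommGroup M] [Module F M]
    {f g : (List (Finset V) →₀ F) →ₗ[F] M} (h : ∀ w, f (word F w) = g (word F w)) : f = g :=
  Finsupp.lhom_ext' fun w => LinearMap.ext_ring (h w)

variable [DecidableEq V]

/-- Put the letter `B` in front of every word. -/
def cons (B : Finset V) : (List (Finset V) →₀ F) →ₗ[F] (List (Finset V) →₀ F) :=
  lin fun w => word F (B :: w)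

/-- Merge `B` into the first letter of every word; the empty word absorbs `B`. -/
def absorb (B : Finset V) : (List (Finset V) →₀ F) →ₗ[F] (List (Finset V) →₀ F) :=
  lin fun w => match w with
    | [] => word F []
    | C :: w => word F ((B ∪ C) :: w)

/-- Drop the first letter. -/
def dropHead : (List (Finset V) →₀ F) →ₗ[F] (List (Finset V) →₀ F) :=
  lin fun w => match w with
    | [] => 0
    | _ :: w => word F w

/-- The alternating sum of all mergers of two neighbouring letters and of the word without its last
letter, on words. -/
def mergeSumFun : List (Finset V) → (List (Finset V) →₀ F)
  | [] => 0
  | B :: w => -absorb B (word F w) - cons B (mergeSumFun w)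

/-- The alternating sum of all mergers of two neighbouring letters and of the word without its last
letter. -/
def mergeSum : (List (Finset V) →₀ F) →ₗ[F] (List (Finset V) →₀ F) :=
  lin mergeSumFun

/-- The boundary map on words. -/
def bdry : (List (Finset V) →₀ F) →ₗ[F] (List (Finset V) →₀ F) :=
  dropHead + mergeSum

omit [DecidableEq V] in
theorem cons_word (B : Finset V) (w : List (Finset V)) :
    cons B (word F w) = word F (B :: w) := by simp [cons]

-- This convention makes the recursion of `mergeSum` drop the last letter: that letter meets an
-- empty tail and disappears.
@[simp]
theorem absorb_nil (B : Finset V) : absorb B (word F []) = word F [] := by simp [absorb]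

theorem absorb_word_cons (B C : Finset V) (w : List (Finset V)) :
    absorb B (word F (C :: w)) = word F ((B ∪ C) :: w) := by simp [absorb]

@[simp]
theorem absorb_cons (B C : Finset V) (u : List (Finset V) →₀ F) :
    absorb B (cons C u) = cons (B ∪ C) u :=
  LinearMap.congr_fun (linearMap_ext (f := absorb B ∘ₗ cons C)
    fun w => by simp [cons_word, absorb]) u

omit [DecidableEq V] in
@[simp]
theorem dropHead_nil : dropHead (word F ([] : List (Finset V))) = 0 := by simp [dropHead]

omit [DecidableEq V] in
@[simp]
theorem dropHead_cons (B : Finset V) (u : List (Finset V) →₀ F) :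
    dropHead (cons B u) = u :=
  LinearMap.congr_fun
    (linearMap_ext (f := dropHead ∘ₗ cons B) (g := LinearMap.id)
      fun w => by simp [cons_word, dropHead]) u

@[simp]
theorem mergeSum_nil : mergeSum (word F ([] : List (Finset V))) = 0 := by
  simp [mergeSum, mergeSumFun]

@[simp]
theorem mergeSum_cons (B : Finset V) (u : List (Finset V) →₀ F) :
    mergeSum (cons B u) = -absorb B u - cons B (mergeSum u) :=
  LinearMap.congr_fun (linearMap_ext (f := mergeSum ∘ₗ cons B)
    (g := -(absorb B : _ →ₗ[F] _) - cons B ∘ₗ mergeSum)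
    fun w => by simp [cons_word, mergeSum, mergeSumFun]) u

/-! ### Valid words and the chain spaces. -/

/-- A word is a list of nonempty pairwise disjoint sets. -/
def Valid (w : List (Finset V)) : Prop :=
  (∀ B ∈ w, B.Nonempty) ∧ w.Pairwise Disjoint

/-- The union of the letters of a word. -/
def union (w : List (Finset V)) : Finset V :=
  w.foldr (· ∪ ·) ∅

@[simp]
theorem union_nil : union ([] : List (Finset V)) = ∅ := rfl

@[simp]
theorem union_cons (B : Finset V) (w : List (Finset V)) : union (B :: w) = B ∪ union w := rfl

theorem mem_union_iff {x : V} {w : List (Finset V)} : x ∈ union w ↔ ∃ B ∈ w, x ∈ B := by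
  induction w with
  | nil => simp
  | cons B w ih => simp [ih]

omit [DecidableEq V] in
theorem valid_nil : Valid ([] : List (Finset V)) := by simp [Valid]

theorem valid_cons {B : Finset V} {w : List (Finset V)} :
    Valid (B :: w) ↔ B.Nonempty ∧ Disjoint B (union w) ∧ Valid w := by
  have : Disjoint B (union w) ↔ ∀ C ∈ w, Disjoint B C := by
    simp only [Finset.disjoint_left, mem_union_iff]
    grind
  rw [this]
  simp only [Valid, List.mem_cons, List.pairwise_cons]
  grind

/-- The span of the words with `p` letters whose union satisfies `Δ`. -/
def chains (F : Type*) [Field F] (Δ : Finset V → Prop) (p : ℕ) :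
    Submodule F (List (Finset V) →₀ F) :=
  Finsupp.supported F F {w | Valid w ∧ w.length = p ∧ Δ (union w)}

theorem word_mem {Δ : Finset V → Prop} {p : ℕ} {w : List (Finset V)} (h : Valid w)
    (hp : w.length = p) (hΔ : Δ (union w)) : word F w ∈ chains F Δ p :=
  Finsupp.single_mem_supported F 1 ⟨h, hp, hΔ⟩

theorem chains_le {Δ : Finset V → Prop} {p : ℕ} {N : Submodule F (List (Finset V) →₀ F)}
    (h : ∀ w, Valid w → w.length = p → Δ (union w) → word F w ∈ N) : chains F Δ p ≤ N := by
  rw [chains, Finsupp.supported_eq_span_single, Submodule.span_le]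
  rintro _ ⟨w, ⟨h1, h2, h3⟩, rfl⟩
  exact h w h1 h2 h3

theorem map_mem {Δ : Finset V → Prop} {p : ℕ} {M : Type*} [AddCommGroup M] [Module F M]
    {N : Submodule F M} {f : (List (Finset V) →₀ F) →ₗ[F] M}
    (h : ∀ w, Valid w → w.length = p → Δ (union w) → f (word F w) ∈ N)
    {u : List (Finset V) →₀ F} (hu : u ∈ chains F Δ p) : f u ∈ N :=
  chains_le (N := N.comap f) h hu

theorem map_eq {Δ : Finset V → Prop} {p : ℕ} {M : Type*} [AddCommGroup M] [Module F M]
    {f g : (List (Finset V) →₀ F) →ₗ[F] M}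
    (h : ∀ w, Valid w → w.length = p → Δ (union w) → f (word F w) = g (word F w))
    {u : List (Finset V) →₀ F} (hu : u ∈ chains F Δ p) : f u = g u :=
  chains_le (N := LinearMap.eqLocus f g) h hu

theorem chains_mono {Δ Δ' : Finset V → Prop} (h : ∀ S, Δ S → Δ' S) (p : ℕ) :
    chains F Δ p ≤ chains F Δ' p :=
  chains_le fun _ h1 h2 h3 => word_mem h1 h2 (h _ h3)

theorem cons_mem {S T : Finset V} {B : Finset V} {p : ℕ} (hB : B.Nonempty) (hS : Disjoint B S)
    (hT : B ∪ S ⊆ T) {u : List (Finset V) →₀ F} (hu : u ∈ chains F (· ⊆ S) p) :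
    cons B u ∈ chains F (· ⊆ T) (p + 1) := by
  refine map_mem (fun w h1 h2 h3 => ?_) hu
  rw [cons_word]
  refine word_mem (valid_cons.2 ⟨hB, hS.mono_right h3, h1⟩) (by simp [h2]) ?_
  rw [union_cons]
  exact (Finset.union_subset_union_right h3).trans hT

theorem absorb_word_mem {B : Finset V} {w : List (Finset V)} (h : Valid (B :: w)) :
    absorb B (word F w) ∈ chains F (· ⊆ union (B :: w)) w.length := by
  cases w with
  | nil =>
    rw [absorb_nil]
    exact word_mem valid_nil rfl (by simp)
  | cons C w =>
    rw [absorb_word_cons]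
    simp only [valid_cons, union_cons] at h
    refine word_mem (valid_cons.2 ⟨h.1.mono Finset.subset_union_left, ?_, h.2.2.2.2⟩) rfl ?_
    · rw [Finset.disjoint_union_left]
      exact ⟨h.2.1.mono_right Finset.subset_union_right, h.2.2.2.1⟩
    · simp [Finset.union_assoc]

/-- Mergers keep the union, but the term without the last letter shrinks it, hence `⊆`. -/
theorem mergeSum_word_mem {p : ℕ} {w : List (Finset V)} (h : Valid w) (hp : w.length = p + 1) :
    mergeSum (word F w) ∈ chains F (· ⊆ union w) p := by
  induction w generalizing p with
  | nil => simp at hp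
  | cons B w ih =>
    obtain rfl : w.length = p := by simpa using hp
    rw [← cons_word, mergeSum_cons]
    refine sub_mem (neg_mem (absorb_word_mem h)) ?_
    have h' := valid_cons.1 h
    cases w with
    | nil => simp
    | cons C w => exact cons_mem h'.1 h'.2.1 subset_rfl (ih h'.2.2 rfl)

/-! ### The operators attached to a vertex. -/

section Vertex

variable (x : V)

/-- Insert the letter `{x}` in all positions, with alternating signs, on words. -/
def shuffleFun : List (Finset V) → (List (Finset V) →₀ F)
  | [] => word F [{x}]
  | B :: w => word F ({x} :: B :: w) - cons B (shuffleFun w)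

/-- Insert the letter `{x}` in all positions, with alternating signs. -/
def shuffle : (List (Finset V) →₀ F) →ₗ[F] (List (Finset V) →₀ F) := lin (shuffleFun x)

/-- Remove `x` from the words, where words with the letter `{x}` are sent to zero, on words. -/
def removeFun : List (Finset V) → (List (Finset V) →₀ F)
  | [] => word F []
  | B :: w => if x ∈ B then (if B = {x} then 0 else word F (B.erase x :: w))
      else cons B (removeFun w)

/-- Remove `x` from the words, where words with the letter `{x}` are sent to zero. -/
def remove : (List (Finset V) →₀ F) →ₗ[F] (List (Finset V) →₀ F) := lin (removeFun x)

/-- The same as `remove` on words that contain `x`, and zero on the other words, on words. -/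
def deleteFun : List (Finset V) → (List (Finset V) →₀ F)
  | [] => 0
  | B :: w => if x ∈ B then (if B = {x} then 0 else word F (B.erase x :: w))
      else cons B (deleteFun w)

/-- The same as `remove` on words that contain `x`, and zero on the other words. -/
def delete : (List (Finset V) →₀ F) →ₗ[F] (List (Finset V) →₀ F) := lin (deleteFun x)

/-- The projection onto the span of the empty word. -/
def nilPart : (List (Finset V) →₀ F) →ₗ[F] (List (Finset V) →₀ F) :=
  lin fun w => match w with
    | [] => word F []
    | _ :: _ => 0

/-- Drop the last letter of the words whose last letter contains `x`, with a sign, on words. -/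
def cutFun : List (Finset V) → (List (Finset V) →₀ F)
  | [] => 0
  | B :: w => (if x ∈ B then nilPart (word F w) else 0) - cons B (cutFun w)

/-- Drop the last letter of the words whose last letter contains `x`, with a sign. -/
def cut : (List (Finset V) →₀ F) →ₗ[F] (List (Finset V) →₀ F) := lin (cutFun x)

/-- Drop the first letter of the words whose first letter is `{x}`. -/
def dropSingleton : (List (Finset V) →₀ F) →ₗ[F] (List (Finset V) →₀ F) :=
  lin fun w => match w with
    | [] => 0
    | B :: w => if B = {x} then word F w else 0

/-- Split `x` off from its letter and move it to all earlier positions, on words. -/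
def splitFun : List (Finset V) → (List (Finset V) →₀ F)
  | [] => 0
  | B :: w => cons {x} (delete x (word F (B :: w))) -
      (if x ∈ B then 0 else cons B (splitFun w))

/-- Split `x` off from its letter and move it to all earlier positions. -/
def split : (List (Finset V) →₀ F) →ₗ[F] (List (Finset V) →₀ F) := lin (splitFun x)

omit [DecidableEq V] in
@[simp]
theorem shuffle_nil : shuffle x (word F []) = word F [{x}] := by simp [shuffle, shuffleFun]

omit [DecidableEq V] in
@[simp]
theorem shuffle_cons (B : Finset V) (u : List (Finset V) →₀ F) :
    shuffle x (cons B u) = cons {x} (cons B u) - cons B (shuffle x u) :=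
  LinearMap.congr_fun (linearMap_ext (f := shuffle x ∘ₗ cons B)
    (g := cons {x} ∘ₗ cons B - cons B ∘ₗ shuffle x)
    fun w => by simp [cons_word, shuffle, shuffleFun]) u

omit [DecidableEq V] in
@[simp]
theorem nilPart_nil : nilPart (word F ([] : List (Finset V))) = word F [] := by simp [nilPart]

omit [DecidableEq V] in
@[simp]
theorem nilPart_cons (B : Finset V) (u : List (Finset V) →₀ F) : nilPart (cons B u) = 0 :=
  LinearMap.congr_fun (linearMap_ext (f := nilPart ∘ₗ cons B) (g := 0)
    fun w => by simp [cons_word, nilPart]) u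

variable {x} {B : Finset V} (u : List (Finset V) →₀ F)

@[simp]
theorem remove_nil : remove x (word F []) = word F [] := by simp [remove, removeFun]

@[simp]
theorem remove_cons_singleton : remove x (cons {x} u) = 0 :=
  LinearMap.congr_fun (linearMap_ext (f := remove x ∘ₗ cons {x}) (g := 0)
    fun w => by simp [cons_word, remove, removeFun]) u

theorem remove_cons_of_mem (h : x ∈ B) (h' : B ≠ {x}) :
    remove x (cons B u) = cons (B.erase x) u :=
  LinearMap.congr_fun (linearMap_ext (f := remove x ∘ₗ cons B) (g := cons (B.erase x))
    fun w => by simp [cons_word, remove, removeFun, h, h']) u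

theorem remove_cons_of_notMem (h : x ∉ B) : remove x (cons B u) = cons B (remove x u) :=
  LinearMap.congr_fun (linearMap_ext (f := remove x ∘ₗ cons B) (g := cons B ∘ₗ remove x)
    fun w => by simp [cons_word, remove, removeFun, h]) u

@[simp]
theorem delete_nil : delete x (word F []) = 0 := by simp [delete, deleteFun]

@[simp]
theorem delete_cons_singleton : delete x (cons {x} u) = 0 :=
  LinearMap.congr_fun (linearMap_ext (f := delete x ∘ₗ cons {x}) (g := 0)
    fun w => by simp [cons_word, delete, deleteFun]) u

theorem delete_cons_of_mem (h : x ∈ B) (h' : B ≠ {x}) :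
    delete x (cons B u) = cons (B.erase x) u :=
  LinearMap.congr_fun (linearMap_ext (f := delete x ∘ₗ cons B) (g := cons (B.erase x))
    fun w => by simp [cons_word, delete, deleteFun, h, h']) u

theorem delete_cons_of_notMem (h : x ∉ B) : delete x (cons B u) = cons B (delete x u) :=
  LinearMap.congr_fun (linearMap_ext (f := delete x ∘ₗ cons B) (g := cons B ∘ₗ delete x)
    fun w => by simp [cons_word, delete, deleteFun, h]) u

@[simp]
theorem cut_nil : cut x (word F []) = 0 := by simp [cut, cutFun]

theorem cut_cons_of_mem (h : x ∈ B) : cut x (cons B u) = nilPart u - cons B (cut x u) :=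
  LinearMap.congr_fun (linearMap_ext (f := cut x ∘ₗ cons B) (g := nilPart - cons B ∘ₗ cut x)
    fun w => by simp [cons_word, cut, cutFun, h]) u

theorem cut_cons_of_notMem (h : x ∉ B) : cut x (cons B u) = -cons B (cut x u) :=
  LinearMap.congr_fun (linearMap_ext (f := cut x ∘ₗ cons B) (g := -(cons B ∘ₗ cut x : _ →ₗ[F] _))
    fun w => by simp [cons_word, cut, cutFun, h]) u

@[simp]
theorem dropSingleton_nil : dropSingleton x (word F []) = 0 := by simp [dropSingleton]

@[simp]
theorem dropSingleton_cons_singleton : dropSingleton x (cons {x} u) = u :=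
  LinearMap.congr_fun (linearMap_ext (f := dropSingleton x ∘ₗ cons {x}) (g := LinearMap.id)
    fun w => by simp [cons_word, dropSingleton]) u

theorem dropSingleton_cons_of_ne (h : B ≠ {x}) : dropSingleton x (cons B u) = 0 :=
  LinearMap.congr_fun (linearMap_ext (f := dropSingleton x ∘ₗ cons B) (g := 0)
    fun w => by simp [cons_word, dropSingleton, h]) u

@[simp]
theorem split_nil : split x (word F []) = 0 := by simp [split, splitFun]

theorem split_cons_of_mem (h : x ∈ B) : split x (cons B u) = cons {x} (delete x (cons B u)) :=
  LinearMap.congr_fun (linearMap_ext (f := split x ∘ₗ cons B)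
    (g := cons {x} ∘ₗ delete x ∘ₗ cons B) fun w => by simp [cons_word, split, splitFun, h]) u

theorem split_cons_of_notMem (h : x ∉ B) :
    split x (cons B u) = cons {x} (cons B (delete x u)) - cons B (split x u) :=
  LinearMap.congr_fun (linearMap_ext (f := split x ∘ₗ cons B)
    (g := cons {x} ∘ₗ cons B ∘ₗ delete x - cons B ∘ₗ split x)
    fun w => by
      simp [cons_word, split, splitFun, h, ← delete_cons_of_notMem]) u

end Vertex

/-! ### Commutation of the vertex operators with the boundary. -/

omit [DecidableEq V] in
@[simp]
theorem word_cons (B : Finset V) (w : List (Finset V)) :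
    word F (B :: w) = cons B (word F w) :=
  (cons_word B w).symm

/-- The insertions of `{x}` just before and just after a letter `B` both merge to `{x} ∪ B`, with
opposite signs. The only term left over inserts `{x}` at the end and then drops it. -/
theorem shuffle_mergeSum (x : V) (u : List (Finset V) →₀ F) :
    shuffle x (mergeSum u) + mergeSum (shuffle x u) = -u := by
  refine LinearMap.congr_fun (linearMap_ext
    (f := shuffle x ∘ₗ mergeSum + mergeSum ∘ₗ shuffle x) (g := -LinearMap.id) fun w => ?_) u
  simp only [LinearMap.add_apply, LinearMap.comp_apply, LinearMap.neg_apply, LinearMap.id_apply]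
  induction w with
  | nil => simp
  | cons B w ih =>
    -- These are the terms that involve the first letter of `w`; `{x} ∪ B` arises once from each
    -- side of `B`.
    have key : -shuffle x (absorb B (word F w)) + cons {x} (absorb B (word F w))
        - cons ({x} ∪ B) (word F w) + absorb B (shuffle x (word F w)) = 0 := by
      cases w with
      | nil => simp [Finset.union_comm]
      | cons C w => simp [Finset.union_comm]
    have ih' := congrArg (cons B) ih
    rw [map_add, map_neg] at ih'
    rw [← cons_word, mergeSum_cons, shuffle_cons, map_sub, map_neg, shuffle_cons, map_sub,
      mergeSum_cons, mergeSum_cons, mergeSum_cons, absorb_cons, map_sub, map_neg]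
    linear_combination (norm := module) key + ih'

theorem shuffle_dropHead (x : V) (u : List (Finset V) →₀ F) :
    shuffle x (dropHead u) + dropHead (shuffle x u) = u := by
  refine LinearMap.congr_fun (linearMap_ext
    (f := shuffle x ∘ₗ dropHead + dropHead ∘ₗ shuffle x) (g := LinearMap.id) fun w => ?_) u
  cases w <;> simp

/-- The defects cancel: `{x}` inserted in front and dropped gives `u`, inserted at the end and
dropped gives `-u`. -/
theorem bdry_shuffle (x : V) (u : List (Finset V) →₀ F) :
    bdry (shuffle x u) = -shuffle x (bdry u) := by
  simp only [bdry, LinearMap.add_apply, map_add]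
  linear_combination (norm := module) shuffle_dropHead x u + shuffle_mergeSum x u

section Vertex

variable {x : V} {w : List (Finset V)}

theorem delete_word (h : x ∉ union w) : delete x (word F w) = 0 := by
  induction w with
  | nil => simp
  | cons B w ih =>
    rw [union_cons, Finset.notMem_union] at h
    rw [← cons_word, delete_cons_of_notMem _ h.1, ih h.2, map_zero]

theorem remove_word (h : x ∉ union w) : remove x (word F w) = word F w := by
  induction w with
  | nil => simp
  | cons B w ih =>
    rw [union_cons, Finset.notMem_union] at h
    rw [← cons_word, remove_cons_of_notMem _ h.1, ih h.2]

theorem cut_word (h : x ∉ union w) : cut x (word F w) = 0 := by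
  induction w with
  | nil => simp
  | cons B w ih =>
    rw [union_cons, Finset.notMem_union] at h
    rw [← cons_word, cut_cons_of_notMem _ h.1, ih h.2, map_zero, neg_zero]

theorem split_word (h : x ∉ union w) : split x (word F w) = 0 := by
  induction w with
  | nil => simp
  | cons B w ih =>
    rw [union_cons, Finset.notMem_union] at h
    rw [← cons_word, split_cons_of_notMem _ h.1, delete_word h.2, ih h.2]
    simp

theorem remove_shuffle_word (h : x ∉ union w) : remove x (shuffle x (word F w)) = 0 := by
  induction w with
  | nil => simp
  | cons B w ih =>
    rw [union_cons, Finset.notMem_union] at h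
    rw [← cons_word, shuffle_cons, map_sub, remove_cons_singleton, remove_cons_of_notMem _ h.1,
      ih h.2]
    simp

theorem cut_shuffle_word (h : x ∉ union w) : cut x (shuffle x (word F w)) = word F w := by
  induction w with
  | nil => simp [cut_cons_of_mem]
  | cons B w ih =>
    rw [union_cons, Finset.notMem_union] at h
    rw [← cons_word, shuffle_cons, map_sub, cut_cons_of_notMem _ h.1, ih h.2,
      cut_cons_of_mem _ (Finset.mem_singleton_self x), cut_cons_of_notMem _ h.1, cut_word h.2]
    simp

theorem erase_union_of_notMem {B C : Finset V} (hB : x ∉ B) :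
    (B ∪ C).erase x = B ∪ C.erase x := by
  rw [Finset.erase_union_distrib, Finset.erase_eq_of_notMem hB]

theorem union_singleton_ne {B : Finset V} (hB : B.Nonempty) (hx : x ∉ B) (C : Finset V) :
    B ∪ C ≠ {x} := by
  obtain ⟨b, hb⟩ := hB
  intro h
  have : b ∈ ({x} : Finset V) := h ▸ Finset.mem_union_left C hb
  exact hx (Finset.mem_singleton.1 this ▸ hb)

theorem erase_union_singleton {B : Finset V} (hB : x ∉ B) : (B ∪ {x}).erase x = B := by
  rw [erase_union_of_notMem hB]; simp

/-- The defect comes from a first letter `{x}`: `remove` kills it before the merger, but turns `B ∪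
{x}` into `B` after it. -/
theorem remove_absorb {B : Finset V} (hB : B.Nonempty) (hx : x ∉ B) (w : List (Finset V)) :
    remove x (absorb B (word F w)) =
      absorb B (remove x (word F w)) + cons B (dropSingleton x (word F w)) := by
  cases w with
  | nil => simp
  | cons C w =>
    rw [← cons_word, absorb_cons]
    by_cases h : x ∈ C
    · rw [remove_cons_of_mem _ (Finset.mem_union_right B h) (union_singleton_ne hB hx C)]
      by_cases hC : C = {x}
      · subst hC
        rw [erase_union_singleton hx]
        simp
      · rw [remove_cons_of_mem _ h hC, absorb_cons, erase_union_of_notMem hx,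
          dropSingleton_cons_of_ne _ hC]
        simp
    · have hC : C ≠ {x} := by rintro rfl; simp at h
      rw [remove_cons_of_notMem _ (by simp [hx, h]), remove_cons_of_notMem _ h, absorb_cons,
        dropSingleton_cons_of_ne _ hC]
      simp

theorem delete_absorb {B : Finset V} (hB : B.Nonempty) (hx : x ∉ B) (w : List (Finset V)) :
    delete x (absorb B (word F w)) =
      absorb B (delete x (word F w)) + cons B (dropSingleton x (word F w)) := by
  cases w with
  | nil => simp
  | cons C w =>
    rw [← cons_word, absorb_cons]
    by_cases h : x ∈ C
    · rw [delete_cons_of_mem _ (Finset.mem_union_right B h) (union_singleton_ne hB hx C)]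
      by_cases hC : C = {x}
      · subst hC
        rw [erase_union_singleton hx]
        simp
      · rw [delete_cons_of_mem _ h hC, absorb_cons, erase_union_of_notMem hx,
          dropSingleton_cons_of_ne _ hC]
        simp
    · have hC : C ≠ {x} := by rintro rfl; simp at h
      rw [delete_cons_of_notMem _ (by simp [hx, h]), delete_cons_of_notMem _ h, absorb_cons,
        dropSingleton_cons_of_ne _ hC]
      simp

/-- The place for `x` between `B` and the next letter exists only before the merger. The second
summand cancels the term where `x` stands there; the first one accounts for a next letter `{x}`,
which `split` would kill. -/
theorem split_absorb {B : Finset V} (hB : B.Nonempty) (hx : x ∉ B) (w : List (Finset V)) :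
    split x (absorb B (word F w)) =
      cons {x} (cons B (dropSingleton x (word F w))) - cons ({x} ∪ B) (delete x (word F w)) +
        cons {x} (absorb B (delete x (word F w))) + absorb B (split x (word F w)) := by
  cases w with
  | nil => simp
  | cons C w =>
    rw [← cons_word, absorb_cons]
    by_cases h : x ∈ C
    · rw [split_cons_of_mem _ (Finset.mem_union_right B h), split_cons_of_mem _ h,
        delete_cons_of_mem _ (Finset.mem_union_right B h) (union_singleton_ne hB hx C)]
      by_cases hC : C = {x}
      · subst hC
        rw [erase_union_singleton hx]
        simp
      · rw [delete_cons_of_mem _ h hC, absorb_cons, erase_union_of_notMem hx,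
          dropSingleton_cons_of_ne _ hC, absorb_cons, Finset.union_comm B {x}]
        simp
    · have hC : C ≠ {x} := by rintro rfl; simp at h
      rw [split_cons_of_notMem _ (by simp [hx, h]), split_cons_of_notMem _ h,
        delete_cons_of_notMem _ h, absorb_cons, dropSingleton_cons_of_ne _ hC, map_sub,
        absorb_cons, absorb_cons, Finset.union_comm B {x}]
      simp only [map_zero]
      abel

theorem cut_absorb {B : Finset V} (hx : x ∉ B) (w : List (Finset V)) :
    cut x (absorb B (word F w)) = absorb B (cut x (word F w)) := by
  cases w with
  | nil => simp
  | cons C w =>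
    rw [← cons_word, absorb_cons]
    by_cases h : x ∈ C
    · rw [cut_cons_of_mem _ (Finset.mem_union_right B h), cut_cons_of_mem _ h, map_sub,
        absorb_cons]
      cases w with
      | nil => simp
      | cons D w => simp
    · rw [cut_cons_of_notMem _ (by simp [hx, h]), cut_cons_of_notMem _ h, map_neg, absorb_cons]

/-- For a letter `{x}` the merger to its right cancels with the merger to its left. Only a first
letter `{x}` has no left partner, which gives the `dropSingleton` term. For a last letter `{x}`,
dropping it replaces the merger to its right. -/
theorem remove_mergeSum (hw : Valid w) :
    remove x (mergeSum (word F w)) =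
      mergeSum (remove x (word F w)) - dropSingleton x (word F w) := by
  induction w with
  | nil => simp
  | cons B w ih =>
    obtain ⟨hB, hd, hw'⟩ := valid_cons.1 hw
    rw [← cons_word]
    by_cases hx : x ∈ B
    · by_cases hC : B = {x}
      · subst hC
        rw [mergeSum_cons, map_sub, map_neg]
        cases w with
        | nil => simp
        | cons C w =>
          rw [← cons_word, absorb_cons]
          have hxC : x ∉ C := fun h => by simp [h] at hd
          have hC : C.Nonempty := (valid_cons.1 hw').1
          rw [Finset.union_comm, remove_cons_of_mem _ (by simp) (union_singleton_ne hC hxC _),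
            erase_union_singleton hxC]
          simp
      · rw [mergeSum_cons, map_sub, map_neg, remove_cons_of_mem _ hx hC,
          remove_cons_of_mem _ hx hC, dropSingleton_cons_of_ne _ hC, mergeSum_cons]
        cases w with
        | nil => simp
        | cons C w =>
          have hxC : x ∉ C := fun h => by
            rw [union_cons, Finset.disjoint_union_right] at hd
            exact Finset.disjoint_left.1 hd.1 hx h
          rw [← cons_word, absorb_cons, Finset.union_comm,
            remove_cons_of_mem _ (by simp [hx])
              (union_singleton_ne (valid_cons.1 hw').1 hxC _), erase_union_of_notMem hxC,
            absorb_cons, Finset.union_comm]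
          simp
    · have hC : B ≠ {x} := by rintro rfl; simp at hx
      have ih' := congrArg (cons B) (ih hw')
      rw [map_sub] at ih'
      rw [mergeSum_cons, map_sub, map_neg, remove_absorb hB hx, remove_cons_of_notMem _ hx,
        remove_cons_of_notMem _ hx, mergeSum_cons, dropSingleton_cons_of_ne _ hC]
      linear_combination (norm := module) -ih'

/-- Compared with `remove`, the term that drops a last letter containing `x` is now sent to zero,
since `x` is gone; `cut` makes up for it. -/
theorem delete_mergeSum (hw : Valid w) :
    delete x (mergeSum (word F w)) =
      mergeSum (delete x (word F w)) + cut x (word F w) - dropSingleton x (word F w) := by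
  induction w with
  | nil => simp
  | cons B w ih =>
    obtain ⟨hB, hd, hw'⟩ := valid_cons.1 hw
    rw [← cons_word]
    by_cases hx : x ∈ B
    · have hxw : x ∉ union w := Finset.disjoint_left.1 hd hx
      rw [cut_cons_of_mem _ hx, cut_word hxw]
      by_cases hC : B = {x}
      · subst hC
        rw [mergeSum_cons, map_sub, map_neg]
        cases w with
        | nil => simp
        | cons C w =>
          rw [← cons_word, absorb_cons]
          have hxC : x ∉ C := fun h => by simp [h] at hd
          have hC : C.Nonempty := (valid_cons.1 hw').1
          rw [Finset.union_comm, delete_cons_of_mem _ (by simp) (union_singleton_ne hC hxC _),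
            erase_union_singleton hxC]
          simp
      · rw [mergeSum_cons, map_sub, map_neg, delete_cons_of_mem _ hx hC,
          delete_cons_of_mem _ hx hC, dropSingleton_cons_of_ne _ hC, mergeSum_cons]
        cases w with
        | nil => simp
        | cons C w =>
          have hxC : x ∉ C := fun h => hxw (by simp [h])
          rw [← cons_word, absorb_cons, Finset.union_comm,
            delete_cons_of_mem _ (by simp [hx])
              (union_singleton_ne (valid_cons.1 hw').1 hxC _), erase_union_of_notMem hxC,
            absorb_cons, Finset.union_comm]
          simp
    · have hC : B ≠ {x} := by rintro rfl; simp at hx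
      have ih' := congrArg (cons B) (ih hw')
      rw [map_sub, map_add] at ih'
      rw [mergeSum_cons, map_sub, map_neg, delete_absorb hB hx, delete_cons_of_notMem _ hx,
        delete_cons_of_notMem _ hx, mergeSum_cons, dropSingleton_cons_of_ne _ hC,
        cut_cons_of_notMem _ hx]
      linear_combination (norm := module) -ih'

/-- Both sides vanish unless `w` has exactly one letter. -/
theorem nilPart_mergeSum_word (w : List (Finset V)) (h : x ∉ union w) {B : Finset V} (hx : x ∈ B) :
    nilPart (mergeSum (word F w)) = -cut x (absorb B (word F w)) := by
  cases w with
  | nil => simp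
  | cons C w =>
    rw [← cons_word, mergeSum_cons, map_sub, map_neg, nilPart_cons, absorb_cons,
      cut_cons_of_mem _ (Finset.mem_union_left C hx), cut_word (fun h' => h (by simp [h']))]
    cases w <;> simp

/-- If `x` is in the last letter, merging the last two letters and cutting equals cutting and
dropping the new last letter. If `x` is in the last letter but one, merging the last two and
dropping the last give the same cut word with opposite signs. -/
theorem cut_mergeSum (hw : Valid w) :
    cut x (mergeSum (word F w)) = -mergeSum (cut x (word F w)) := by
  induction w with
  | nil => simp
  | cons B w ih =>
    obtain ⟨hB, hd, hw'⟩ := valid_cons.1 hw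
    rw [← cons_word]
    by_cases hx : x ∈ B
    · have hxw : x ∉ union w := Finset.disjoint_left.1 hd hx
      have h0 : cut x (mergeSum (word F w)) = 0 := by
        cases w with
        | nil => simp
        | cons C w =>
          exact map_eq (g := 0) (fun w' _ _ h' => cut_word fun hx' => hxw (h' hx'))
            (mergeSum_word_mem hw' rfl)
      have h1 : mergeSum (nilPart (word F w)) = 0 := by
        cases w <;> simp
      rw [mergeSum_cons, map_sub, map_neg, cut_cons_of_mem _ hx, cut_cons_of_mem _ hx, h0,
        cut_word hxw, nilPart_mergeSum_word w hxw hx, map_sub, h1]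
      simp
    · have ih' := congrArg (cons B) (ih hw')
      rw [map_neg] at ih'
      rw [mergeSum_cons, map_sub, map_neg, cut_absorb hx, cut_cons_of_notMem _ hx,
        cut_cons_of_notMem _ hx, map_neg, mergeSum_cons]
      linear_combination (norm := module) ih'

/-- The `dropSingleton` defect of `mergeSum` cancels with that of `dropHead`: dropping a first
letter `{x}` leaves a word that `remove` does not kill. -/
theorem bdry_remove (hw : Valid w) :
    bdry (remove x (word F w)) = remove x (bdry (word F w)) := by
  simp only [bdry, LinearMap.add_apply, map_add, remove_mergeSum hw]
  suffices h : remove x (dropHead (word F w)) =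
      dropHead (remove x (word F w)) + dropSingleton x (word F w) by rw [h]; abel
  cases w with
  | nil => simp
  | cons B w =>
    rw [← cons_word]
    by_cases hx : x ∈ B
    · have hxw : x ∉ union w := Finset.disjoint_left.1 (valid_cons.1 hw).2.1 hx
      by_cases hC : B = {x}
      · subst hC
        simp [remove_word hxw]
      · rw [remove_cons_of_mem _ hx hC, dropSingleton_cons_of_ne _ hC]
        simp [remove_word hxw]
    · have hC : B ≠ {x} := by rintro rfl; simp at hx
      rw [remove_cons_of_notMem _ hx, dropSingleton_cons_of_ne _ hC]
      simp

theorem bdry_cut (hw : Valid w) :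
    bdry (cut x (word F w)) = -cut x (bdry (word F w)) := by
  simp only [bdry, LinearMap.add_apply, map_add, cut_mergeSum hw]
  suffices h : cut x (dropHead (word F w)) = -dropHead (cut x (word F w)) by rw [h]; abel
  cases w with
  | nil => simp
  | cons B w =>
    rw [← cons_word]
    by_cases hx : x ∈ B
    · have hxw : x ∉ union w := Finset.disjoint_left.1 (valid_cons.1 hw).2.1 hx
      rw [cut_cons_of_mem _ hx, dropHead_cons, cut_word hxw]
      cases w <;> simp
    · rw [cut_cons_of_notMem _ hx]
      simp

/-- Let `x` lie in a letter `B ≠ {x}`. The mergers of the split-off `{x}` with its neighbours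
telescope, except for the merger back into `B`, which gives `-w`. If `B` is the last letter,
dropping what is left of it leaves `{x}` in all positions of the shortened word: this is `shuffle x
(cut x w)`. For a letter `{x}` the same terms come from `split x ∘ mergeSum`. The difference `remove
- delete` is `w` on words without `x` and zero otherwise. -/
theorem split_mergeSum (hw : Valid w) :
    mergeSum (split x (word F w)) + split x (mergeSum (word F w)) =
      shuffle x (cut x (word F w)) + remove x (word F w) - delete x (word F w) - word F w := by
  induction w with
  | nil => simp
  | cons B w ih =>
    obtain ⟨hB, hd, hw'⟩ := valid_cons.1 hw
    rw [← cons_word]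
    by_cases hx : x ∈ B
    · have hxw : x ∉ union w := Finset.disjoint_left.1 hd hx
      rw [split_cons_of_mem _ hx, mergeSum_cons, mergeSum_cons, map_sub, map_neg,
        split_cons_of_mem _ hx, cut_cons_of_mem _ hx, cut_word hxw]
      by_cases hC : B = {x}
      · subst hC
        cases w with
        | nil => simp
        | cons C w =>
          have hxC : x ∉ C := fun h => hxw (by simp [h])
          rw [← cons_word, absorb_cons, split_cons_of_mem _ (by simp), Finset.union_comm,
            delete_cons_of_mem _ (by simp) (union_singleton_ne (valid_cons.1 hw').1 hxC _),
            erase_union_singleton hxC]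
          simp
      · have hi : {x} ∪ B.erase x = B := by
          rw [← Finset.insert_eq, Finset.insert_erase hx]
        rw [delete_cons_of_mem _ hx hC, delete_cons_of_mem _ hx hC, mergeSum_cons, absorb_cons, hi,
          remove_cons_of_mem _ hx hC, map_sub, map_neg]
        cases w with
        | nil => simp; abel
        | cons C w =>
          have hxC : x ∉ C := fun h => hxw (by simp [h])
          rw [← cons_word, absorb_cons, absorb_cons, split_cons_of_mem _ (by simp [hx]),
            Finset.union_comm B C,
            delete_cons_of_mem _ (by simp [hx])
              (union_singleton_ne (valid_cons.1 hw').1 hxC _), erase_union_of_notMem hxC,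
            Finset.union_comm C]
          simp
    · have ih' := congrArg (cons B) (ih hw')
      simp only [map_sub, map_add] at ih'
      rw [split_cons_of_notMem _ hx, cut_cons_of_notMem _ hx, remove_cons_of_notMem _ hx,
        delete_cons_of_notMem _ hx]
      simp only [mergeSum_cons, map_sub, map_neg, absorb_cons]
      rw [split_absorb hB hx, split_cons_of_notMem _ hx, shuffle_cons, delete_mergeSum hw']
      simp only [map_sub, map_add]
      linear_combination (norm := module) ih'

theorem split_dropHead (hw : Valid w) :
    dropHead (split x (word F w)) + split x (dropHead (word F w)) = delete x (word F w) := by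
  cases w with
  | nil => simp
  | cons B w =>
    rw [← cons_word]
    by_cases hx : x ∈ B
    · have hxw : x ∉ union w := Finset.disjoint_left.1 (valid_cons.1 hw).2.1 hx
      rw [split_cons_of_mem _ hx]
      simp [split_word hxw]
    · rw [split_cons_of_notMem _ hx, delete_cons_of_notMem _ hx]
      simp

theorem bdry_split (hw : Valid w) :
    bdry (split x (word F w)) + split x (bdry (word F w)) =
      remove x (word F w) + shuffle x (cut x (word F w)) - word F w := by
  simp only [bdry, LinearMap.add_apply, map_add]
  linear_combination (norm := module) split_mergeSum (F := F) (x := x) hw +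
    split_dropHead (F := F) (x := x) hw

end Vertex

end Words

/-! ### Direct sum decompositions of subquotients. -/

section Subquotient

variable {F : Type*} [Field F] {M : Type*} [AddCommGroup M] [Module F M]

/-- The quotient of `Z` by its intersection with `B`. -/
abbrev Subquotient (Z B : Submodule F M) : Type _ := Z ⧸ B.submoduleOf Z

theorem mem_submoduleOf_iff {Z B : Submodule F M} {z : Z} : z ∈ B.submoduleOf Z ↔ (z : M) ∈ B :=
  Iff.rfl

theorem subquotient_mk_eq_zero {Z B : Submodule F M} (z : Z) :
    (Submodule.Quotient.mk z : Subquotient Z B) = 0 ↔ (z : M) ∈ B :=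
  (Submodule.Quotient.mk_eq_zero _).trans mem_submoduleOf_iff

/-- A linear map into a subquotient. -/
def subquotientMap {Z Z₁ B B₁ : Submodule F M} (f : M →ₗ[F] M)
    (hZ : ∀ z ∈ Z₁, f z ∈ Z) (hB : ∀ b ∈ B₁, f b ∈ B) : Subquotient Z₁ B₁ →ₗ[F] Subquotient Z B :=
  Submodule.mapQ _ _ (f.restrict hZ) fun z hz =>
    Submodule.mem_comap.2 (mem_submoduleOf_iff.2 (hB z (mem_submoduleOf_iff.1 hz)))

theorem subquotientMap_mk {Z Z₁ B B₁ : Submodule F M} (f : M →ₗ[F] M)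
    (hZ : ∀ z ∈ Z₁, f z ∈ Z) (hB : ∀ b ∈ B₁, f b ∈ B) (z : Z₁) :
    subquotientMap f hZ hB (Submodule.Quotient.mk z) =
      Submodule.Quotient.mk (⟨f z, hZ z z.2⟩ : Z) := rfl

/-- A subquotient is the product of two others if it is decomposed by the inclusion of the first and
a linear map on the second. -/
theorem subquotient_equiv_prod {Z Z₁ Z₂ B B₁ B₂ : Submodule F M} (f : M →ₗ[F] M)
    (hZ₁ : Z₁ ≤ Z) (hB₁ : B₁ ≤ B) (hZ₂ : ∀ z ∈ Z₂, f z ∈ Z) (hB₂ : ∀ b ∈ B₂, f b ∈ B)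
    (hsurj : ∀ z ∈ Z, ∃ z₁ ∈ Z₁, ∃ z₂ ∈ Z₂, z₁ + f z₂ - z ∈ B)
    (hinj : ∀ z₁ ∈ Z₁, ∀ z₂ ∈ Z₂, z₁ + f z₂ ∈ B → z₁ ∈ B₁ ∧ z₂ ∈ B₂) :
    Nonempty ((Subquotient Z₁ B₁ × Subquotient Z₂ B₂) ≃ₗ[F] Subquotient Z B) := by
  refine ⟨LinearEquiv.ofBijective ((subquotientMap LinearMap.id hZ₁ hB₁).coprod
    (subquotientMap f hZ₂ hB₂)) ⟨?_, ?_⟩⟩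
  · rw [injective_iff_map_eq_zero]
    rintro ⟨a, b⟩ h
    induction a using Submodule.Quotient.induction_on with | _ a
    induction b using Submodule.Quotient.induction_on with | _ b
    rw [LinearMap.coprod_apply, subquotientMap_mk, subquotientMap_mk, ← Submodule.Quotient.mk_add,
      subquotient_mk_eq_zero] at h
    obtain ⟨ha, hb⟩ := hinj a a.2 b b.2 h
    exact Prod.ext ((subquotient_mk_eq_zero _).2 ha) ((subquotient_mk_eq_zero _).2 hb)
  · intro z
    induction z using Submodule.Quotient.induction_on with | _ z
    obtain ⟨z₁, h₁, z₂, h₂, h⟩ := hsurj z z.2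
    refine ⟨(Submodule.Quotient.mk ⟨z₁, h₁⟩, Submodule.Quotient.mk ⟨z₂, h₂⟩), ?_⟩
    rw [LinearMap.coprod_apply, subquotientMap_mk, subquotientMap_mk, ← Submodule.Quotient.mk_add,
      Submodule.Quotient.eq, mem_submoduleOf_iff]
    exact h

end Subquotient

namespace Words

variable {F : Type*} [Field F] {V : Type*} [DecidableEq V]

/-! ### The vertex operators between `Δ`, the deletion and the link. -/

section Membership

variable {x : V} {w : List (Finset V)}

theorem remove_word_mem (hw : Valid w) :
    remove x (word F w) ∈ chains F (· ⊆ (union w).erase x) w.length := by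
  induction w with
  | nil =>
    rw [remove_nil]
    exact word_mem valid_nil rfl (by simp)
  | cons B w ih =>
    obtain ⟨hB, hd, hw'⟩ := valid_cons.1 hw
    rw [word_cons]
    by_cases hx : x ∈ B
    · have hxw : x ∉ union w := Finset.disjoint_left.1 hd hx
      by_cases hC : B = {x}
      · subst hC
        simp
      · rw [remove_cons_of_mem _ hx hC]
        refine cons_mem (S := union w) ?_ (hd.mono_left (Finset.erase_subset x B)) ?_
          (word_mem hw' rfl subset_rfl)
        · rw [Finset.erase_nonempty hx]
          exact (Finset.nontrivial_iff_ne_singleton hx).2 hC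
        · rw [union_cons, Finset.erase_union_distrib, Finset.erase_eq_of_notMem hxw]
    · rw [remove_cons_of_notMem _ hx]
      refine cons_mem hB (hd.mono_right (Finset.erase_subset x _)) ?_ (ih hw')
      rw [union_cons, erase_union_of_notMem hx]

theorem delete_word_mem (hw : Valid w) :
    delete x (word F w) ∈ chains F (· ⊆ (union w).erase x) w.length := by
  induction w with
  | nil =>
    rw [delete_nil]
    exact zero_mem _
  | cons B w ih =>
    obtain ⟨hB, hd, hw'⟩ := valid_cons.1 hw
    rw [word_cons]
    by_cases hx : x ∈ B
    · by_cases hC : B = {x}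
      · subst hC
        simp
      · have h := remove_word_mem (F := F) (x := x) hw
        rw [word_cons, remove_cons_of_mem _ hx hC] at h
        rwa [delete_cons_of_mem _ hx hC]
    · rw [delete_cons_of_notMem _ hx]
      refine cons_mem hB (hd.mono_right (Finset.erase_subset x _)) ?_ (ih hw')
      rw [union_cons, erase_union_of_notMem hx]

theorem split_word_mem (hw : Valid w) :
    split x (word F w) ∈ chains F (· ⊆ union w) (w.length + 1) := by
  induction w with
  | nil =>
    rw [split_nil]
    exact zero_mem _
  | cons B w ih =>
    obtain ⟨hB, hd, hw'⟩ := valid_cons.1 hw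
    by_cases hxw : x ∈ union (B :: w)
    · have h : cons {x} (delete x (word F (B :: w))) ∈
          chains F (· ⊆ union (B :: w)) ((B :: w).length + 1) :=
        cons_mem (Finset.singleton_nonempty x) (by simp)
          (by rw [← Finset.insert_eq, Finset.insert_erase hxw]) (delete_word_mem hw)
      rw [word_cons] at h ⊢
      by_cases hx : x ∈ B
      · rwa [split_cons_of_mem _ hx]
      · rw [split_cons_of_notMem _ hx, ← delete_cons_of_notMem _ hx]
        exact sub_mem h (cons_mem hB hd subset_rfl (ih hw'))
    · rw [Words.split_word hxw]
      exact zero_mem _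

theorem cut_word_mem {p : ℕ} (hw : Valid w) (hp : w.length = p + 1) :
    cut x (word F w) ∈ chains F (· ⊆ (union w).erase x) p := by
  induction w generalizing p with
  | nil => simp at hp
  | cons B w ih =>
    obtain rfl : w.length = p := by simpa using hp
    obtain ⟨hB, hd, hw'⟩ := valid_cons.1 hw
    rw [word_cons]
    by_cases hx : x ∈ B
    · rw [cut_cons_of_mem _ hx, cut_word (Finset.disjoint_left.1 hd hx)]
      cases w with
      | nil =>
        rw [nilPart_nil, map_zero, sub_zero]
        exact word_mem valid_nil rfl (by simp)
      | cons C w => simp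
    · rw [cut_cons_of_notMem _ hx]
      refine neg_mem ?_
      cases w with
      | nil => simp
      | cons C w =>
        refine cons_mem hB (hd.mono_right (Finset.erase_subset x _)) ?_ (ih hw' rfl)
        rw [union_cons B, erase_union_of_notMem hx]

theorem shuffle_word_mem (hw : Valid w) (hx : x ∉ union w) :
    shuffle x (word F w) ∈ chains F (· ⊆ insert x (union w)) (w.length + 1) := by
  induction w with
  | nil =>
    rw [shuffle_nil]
    exact word_mem (valid_cons.2 ⟨by simp, by simp, valid_nil⟩) rfl (by simp)
  | cons B w ih =>
    obtain ⟨hB, hd, hw'⟩ := valid_cons.1 hw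
    have hx' := hx
    rw [union_cons, Finset.notMem_union] at hx'
    rw [word_cons, shuffle_cons]
    refine sub_mem ?_ (cons_mem hB ?_ ?_ (ih hw' hx'.2))
    · rw [← word_cons]
      exact cons_mem (S := union (B :: w)) (by simp) (by simpa using hx)
        (by rw [Finset.insert_eq]) (word_mem hw rfl subset_rfl)
    · rw [Finset.disjoint_insert_right]
      exact ⟨hx'.1, hd⟩
    · simp

variable {Δ : Finset V → Prop}

/-- The faces of `Δ` that do not contain `x`. -/
def deletion (Δ : Finset V → Prop) (x : V) (S : Finset V) : Prop := x ∉ S ∧ Δ S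

/-- The link of `x` in `Δ`. -/
def link (Δ : Finset V → Prop) (x : V) (S : Finset V) : Prop := x ∉ S ∧ Δ (insert x S)

theorem remove_mem (hΔ : ∀ S T, S ⊆ T → Δ T → Δ S) {p : ℕ} {u : List (Finset V) →₀ F}
    (hu : u ∈ chains F Δ p) : remove x u ∈ chains F (deletion Δ x) p := by
  refine map_mem (fun w hw hp h => ?_) hu
  subst hp
  exact chains_mono (fun S hS => ⟨fun hx => by simpa using hS hx,
    hΔ _ _ (hS.trans (Finset.erase_subset x _)) h⟩) _ (remove_word_mem hw)

theorem split_mem (hΔ : ∀ S T, S ⊆ T → Δ T → Δ S) {p : ℕ} {u : List (Finset V) →₀ F}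
    (hu : u ∈ chains F Δ p) : split x u ∈ chains F Δ (p + 1) := by
  refine map_mem (fun w hw hp h => ?_) hu
  subst hp
  exact chains_mono (fun S hS => hΔ _ _ hS h) _ (split_word_mem hw)

theorem cut_mem (hΔ : ∀ S T, S ⊆ T → Δ T → Δ S) {p : ℕ} {u : List (Finset V) →₀ F}
    (hu : u ∈ chains F Δ (p + 1)) : cut x u ∈ chains F (link Δ x) p := by
  refine map_mem (fun w hw hp h => ?_) hu
  by_cases hx : x ∈ union w
  · exact chains_mono (fun S hS => ⟨fun hx => by simpa using hS hx,
      hΔ _ _ (Finset.insert_subset hx (hS.trans (Finset.erase_subset x _))) h⟩) _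
      (cut_word_mem hw hp)
  · rw [cut_word hx]
    exact zero_mem _

theorem shuffle_mem (hΔ : ∀ S T, S ⊆ T → Δ T → Δ S) {p : ℕ} {u : List (Finset V) →₀ F}
    (hu : u ∈ chains F (link Δ x) p) : shuffle x u ∈ chains F Δ (p + 1) := by
  refine map_mem (fun w hw hp h => ?_) hu
  subst hp
  exact chains_mono (fun S hS => hΔ _ _ hS h.2) _ (shuffle_word_mem hw h.1)

theorem cut_eq_zero {u : List (Finset V) →₀ F} (hu : u ∈ chains F Δ 0) : cut x u = 0 := by
  refine map_eq (g := 0) (fun w _ hp _ => ?_) hu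
  rw [List.length_eq_zero_iff] at hp
  simp [hp]

theorem bdry_eq_zero {u : List (Finset V) →₀ F} (hu : u ∈ chains F Δ 0) : bdry u = 0 := by
  refine map_eq (g := 0) (fun w _ hp _ => ?_) hu
  rw [List.length_eq_zero_iff] at hp
  simp [hp, bdry]

end Membership

/-! ### The homology of words and the face numbers. -/

/-- The cycles with `p` letters. -/
def cyc (F : Type*) [Field F] (Δ : Finset V → Prop) (p : ℕ) : Submodule F (List (Finset V) →₀ F) :=
  chains F Δ p ⊓ LinearMap.ker bdry

/-- The boundaries with `p` letters. -/
def bds (F : Type*) [Field F] (Δ : Finset V → Prop) (p : ℕ) : Submodule F (List (Finset V) →₀ F) :=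
  (chains F Δ (p + 1)).map bdry

/-- The homology of the complex of words. -/
abbrev Homology (F : Type*) [Field F] (Δ : Finset V → Prop) (p : ℕ) : Type _ :=
  Subquotient (cyc F Δ p) (bds F Δ p)

theorem mem_cyc {Δ : Finset V → Prop} {p : ℕ} {z : List (Finset V) →₀ F} :
    z ∈ cyc F Δ p ↔ z ∈ chains F Δ p ∧ bdry z = 0 := by
  rw [cyc, Submodule.mem_inf, LinearMap.mem_ker]

theorem mem_bds {Δ : Finset V → Prop} {p : ℕ} {z : List (Finset V) →₀ F} :
    z ∈ bds F Δ p ↔ ∃ u ∈ chains F Δ (p + 1), bdry u = z := by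
  rw [bds, Submodule.mem_map]

variable {Δ : Finset V → Prop} (hΔ : ∀ S T, S ⊆ T → Δ T → Δ S) (x : V) {p : ℕ}
include hΔ

omit hΔ in
theorem cyc_deletion_le : cyc F (deletion Δ x) p ≤ cyc F Δ p :=
  inf_le_inf_right _ (chains_mono (fun _ h => h.2) p)

omit hΔ in
theorem bds_deletion_le : bds F (deletion Δ x) p ≤ bds F Δ p :=
  Submodule.map_mono (chains_mono (fun _ h => h.2) _)

omit hΔ in
theorem bdry_remove_of_mem {u : List (Finset V) →₀ F} (hu : u ∈ chains F Δ p) :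
    bdry (remove x u) = remove x (bdry u) := by
  have := map_eq (f := bdry ∘ₗ remove x) (g := remove x ∘ₗ bdry)
    (fun w hw _ _ => by simpa only [LinearMap.comp_apply] using bdry_remove hw) hu
  simpa only [LinearMap.comp_apply] using this

omit hΔ in
theorem bdry_cut_of_mem {u : List (Finset V) →₀ F} (hu : u ∈ chains F Δ p) :
    bdry (cut x u) = -cut x (bdry u) := by
  have := map_eq (f := bdry ∘ₗ cut x) (g := -(cut x ∘ₗ bdry : _ →ₗ[F] _))
    (fun w hw _ _ => by
      simpa only [LinearMap.comp_apply, LinearMap.neg_apply] using bdry_cut hw) hu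
  simpa only [LinearMap.comp_apply, LinearMap.neg_apply] using this

omit hΔ in
theorem bdry_split_of_mem {u : List (Finset V) →₀ F} (hu : u ∈ chains F Δ p) :
    bdry (split x u) + split x (bdry u) = remove x u + shuffle x (cut x u) - u := by
  have := map_eq (f := bdry ∘ₗ split x + split x ∘ₗ bdry)
    (g := remove x + shuffle x ∘ₗ cut x - LinearMap.id)
    (fun w hw _ _ => by
      simpa only [LinearMap.comp_apply, LinearMap.add_apply, LinearMap.sub_apply,
        LinearMap.id_apply] using bdry_split hw) hu
  simpa only [LinearMap.comp_apply, LinearMap.add_apply, LinearMap.sub_apply,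
    LinearMap.id_apply] using this

theorem remove_mem_cyc {z : List (Finset V) →₀ F} (hz : z ∈ cyc F Δ p) :
    remove x z ∈ cyc F (deletion Δ x) p := by
  obtain ⟨h, h'⟩ := mem_cyc.1 hz
  exact mem_cyc.2 ⟨remove_mem hΔ h, by rw [bdry_remove_of_mem x h, h', map_zero]⟩

theorem remove_mem_bds {z : List (Finset V) →₀ F} (hz : z ∈ bds F Δ p) :
    remove x z ∈ bds F (deletion Δ x) p := by
  obtain ⟨u, hu, rfl⟩ := mem_bds.1 hz
  exact mem_bds.2 ⟨remove x u, remove_mem hΔ hu, bdry_remove_of_mem x hu⟩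

theorem decomposition_mem_bds {z : List (Finset V) →₀ F} (hz : z ∈ cyc F Δ p) :
    remove x z + shuffle x (cut x z) - z ∈ bds F Δ p := by
  obtain ⟨h, h'⟩ := mem_cyc.1 hz
  rw [← bdry_split_of_mem x h, h', map_zero, add_zero]
  exact mem_bds.2 ⟨split x z, split_mem hΔ h, rfl⟩

omit hΔ in
theorem remove_eq_self {u : List (Finset V) →₀ F} (hu : u ∈ chains F (deletion Δ x) p) :
    remove x u = u := by
  simpa only [LinearMap.id_apply] using
    map_eq (g := LinearMap.id) (fun w _ _ h => by simpa using remove_word h.1) hu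

omit hΔ in
theorem cut_deletion {u : List (Finset V) →₀ F} (hu : u ∈ chains F (deletion Δ x) p) :
    cut x u = 0 := by
  simpa only [LinearMap.zero_apply] using
    map_eq (g := 0) (fun w _ _ h => by simpa using cut_word h.1) hu

omit hΔ in
theorem remove_shuffle {u : List (Finset V) →₀ F} (hu : u ∈ chains F (link Δ x) p) :
    remove x (shuffle x u) = 0 := by
  simpa only [LinearMap.zero_apply, LinearMap.comp_apply] using
    map_eq (f := remove x ∘ₗ shuffle x) (g := 0)
      (fun w _ _ h => by simpa using remove_shuffle_word h.1) hu

omit hΔ in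
theorem cut_shuffle {u : List (Finset V) →₀ F} (hu : u ∈ chains F (link Δ x) p) :
    cut x (shuffle x u) = u := by
  simpa only [LinearMap.id_apply, LinearMap.comp_apply] using
    map_eq (f := cut x ∘ₗ shuffle x) (g := LinearMap.id)
      (fun w _ _ h => by simpa using cut_shuffle_word h.1) hu

/-- Surjectivity is the homotopy formula on cycles. Injectivity holds because `remove x` and `cut x`
recover the two summands exactly and preserve boundaries. -/
theorem homology_succ_equiv :
    Nonempty ((Homology F (deletion Δ x) (p + 1) × Homology F (link Δ x) p) ≃ₗ[F]
      Homology F Δ (p + 1)) := by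
  refine subquotient_equiv_prod (shuffle x) (cyc_deletion_le x) (bds_deletion_le x) ?_ ?_ ?_ ?_
  · intro z hz
    obtain ⟨h, h'⟩ := mem_cyc.1 hz
    exact mem_cyc.2 ⟨shuffle_mem hΔ h, by rw [bdry_shuffle, h', map_zero, neg_zero]⟩
  · intro z hz
    obtain ⟨u, hu, rfl⟩ := mem_bds.1 hz
    -- The sign appears because `shuffle x` anticommutes with `bdry`; the same happens below for
    -- `cut x`.
    exact mem_bds.2 ⟨-shuffle x u, neg_mem (shuffle_mem hΔ hu), by
      rw [map_neg, bdry_shuffle, neg_neg]⟩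
  · intro z hz
    obtain ⟨h, h'⟩ := mem_cyc.1 hz
    exact ⟨_, remove_mem_cyc hΔ x hz, cut x z, mem_cyc.2 ⟨cut_mem hΔ h, by
      rw [bdry_cut_of_mem x h, h', map_zero, neg_zero]⟩, decomposition_mem_bds hΔ x hz⟩
  · intro z₁ h₁ z₂ h₂ h
    obtain ⟨h₁, -⟩ := mem_cyc.1 h₁
    obtain ⟨h₂, -⟩ := mem_cyc.1 h₂
    constructor
    · have := remove_mem_bds hΔ x h
      rwa [map_add, remove_eq_self x h₁, remove_shuffle x h₂, add_zero] at this
    · obtain ⟨u, hu, h⟩ := mem_bds.1 h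
      refine mem_bds.2 ⟨-cut x u, neg_mem (cut_mem hΔ hu), ?_⟩
      rw [map_neg, bdry_cut_of_mem x hu, h, map_add, cut_deletion x h₁, cut_shuffle x h₂]
      simp

/-- Without letters there is nothing to cut, so the link contributes zero; the trivial factor only
brings this into the form of `subquotient_equiv_prod`. -/
theorem homology_zero_equiv :
    Nonempty ((Homology F (deletion Δ x) 0 ×
      Subquotient (⊥ : Submodule F (List (Finset V) →₀ F)) ⊥) ≃ₗ[F] Homology F Δ 0) := by
  refine subquotient_equiv_prod 0 (cyc_deletion_le x) (bds_deletion_le x) ?_ ?_ ?_ ?_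
  · intro z _
    exact zero_mem _
  · intro z _
    exact zero_mem _
  · intro z hz
    refine ⟨_, remove_mem_cyc hΔ x hz, 0, zero_mem _, ?_⟩
    have h := decomposition_mem_bds hΔ x hz
    rw [cut_eq_zero (mem_cyc.1 hz).1, map_zero] at h
    exact h
  · intro z₁ h₁ z₂ h₂ h
    have := remove_mem_bds hΔ x h
    rw [LinearMap.zero_apply, add_zero, remove_eq_self x (mem_cyc.1 h₁).1] at this
    exact ⟨this, h₂⟩

omit hΔ in
-- The recursion that matches `homology_succ_equiv`: the faces containing `x` correspond to the
-- faces of the link.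
theorem ncard_faces_succ (hfin : {S | Δ S}.Finite) :
    {S | Δ S ∧ S.card = p + 1}.ncard =
      {S | deletion Δ x S ∧ S.card = p + 1}.ncard + {S | link Δ x S ∧ S.card = p}.ncard := by
  have h2 : ((insert x) '' {S | link Δ x S ∧ S.card = p}).ncard =
      {S | link Δ x S ∧ S.card = p}.ncard := by
    refine Set.InjOn.ncard_image fun S hS T hT h => ?_
    rw [← Finset.erase_insert hS.1.1, ← Finset.erase_insert hT.1.1, h]
  have hu : {S | Δ S ∧ S.card = p + 1} = {S | deletion Δ x S ∧ S.card = p + 1} ∪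
      (insert x) '' {S | link Δ x S ∧ S.card = p} := by
    ext S
    simp only [Set.mem_ofPred_eq, Set.mem_union, Set.mem_image, deletion, link]
    constructor
    · rintro ⟨h, hc⟩
      by_cases hx : x ∈ S
      · refine Or.inr ⟨S.erase x, ⟨⟨by simp, ?_⟩, ?_⟩, Finset.insert_erase hx⟩
        · rwa [Finset.insert_erase hx]
        · rw [Finset.card_erase_of_mem hx, hc]; rfl
      · exact Or.inl ⟨⟨hx, h⟩, hc⟩
    · rintro (⟨⟨_, h⟩, hc⟩ | ⟨T, ⟨⟨hx, h⟩, hc⟩, rfl⟩)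
      · exact ⟨h, hc⟩
      · exact ⟨h, by rw [Finset.card_insert_of_notMem hx, hc]⟩
  rw [← h2, hu, Set.ncard_union_eq ?_ (hfin.subset fun S hS => hS.1.2) (hfin.subset ?_)]
  · rw [Set.disjoint_left]
    rintro _ ⟨⟨h, _⟩, _⟩ ⟨T, _, rfl⟩
    exact h (Finset.mem_insert_self x T)
  · rintro _ ⟨T, hT, rfl⟩
    exact hT.1.2

omit [DecidableEq V] hΔ in
theorem ncard_faces_zero :
    {S | Δ S ∧ S.card = 0}.ncard = {S | deletion Δ x S ∧ S.card = 0}.ncard := by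
  congr 1
  ext S
  simp only [Set.mem_ofPred_eq, deletion, Finset.card_eq_zero]
  constructor
  · rintro ⟨h, rfl⟩
    exact ⟨⟨Finset.notMem_empty x, h⟩, rfl⟩
  · rintro ⟨⟨_, h⟩, rfl⟩
    exact ⟨h, rfl⟩

omit hΔ in
-- Only the empty word can occur. Two complexes are covered: the one with the single face `∅`, and
-- the one with no face at all.
theorem finrank_homology_of_subset_empty (h : ∀ S, Δ S → S ⊆ ∅) :
    Module.Finite F (Homology F Δ p) ∧
      Module.finrank F (Homology F Δ p) = {S | Δ S ∧ S.card = p}.ncard := by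
  have hw : ∀ w : List (Finset V), Valid w → Δ (union w) → w = [] := by
    intro w hv hΔ
    cases w with
    | nil => rfl
    | cons B w =>
      obtain ⟨b, hb⟩ := (valid_cons.1 hv).1
      have := h _ hΔ (Finset.mem_union_left (union w) hb)
      simp at this
  by_cases hp : p = 0 ∧ Δ ∅
  · obtain ⟨rfl, he⟩ := hp
    have h0 : cyc F Δ 0 = Submodule.span F {word F []} := by
      refine le_antisymm (inf_le_left.trans (chains_le fun w hv _ hΔ => ?_)) ?_
      · rw [hw w hv hΔ]
        exact Submodule.mem_span_singleton_self _
      · rw [Submodule.span_singleton_le_iff_mem]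
        have : word F [] ∈ chains F Δ 0 := word_mem valid_nil rfl he
        exact mem_cyc.2 ⟨this, bdry_eq_zero this⟩
    have h1 : bds F Δ 0 = ⊥ := by
      have : chains F Δ 1 = ⊥ := le_bot_iff.1 (chains_le fun w hv hl hΔ => by
        rw [hw w hv hΔ] at hl; simp at hl)
      rw [bds, this, Submodule.map_bot]
    have e : Homology F Δ 0 ≃ₗ[F] cyc F Δ 0 :=
      Submodule.quotEquivOfEqBot _ (by
        rw [h1, Submodule.submoduleOf, Submodule.comap_bot, Submodule.ker_subtype])
    have hfin : Module.Finite F (cyc F Δ 0) := by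
      rw [h0]; infer_instance
    refine ⟨Module.Finite.equiv e.symm, ?_⟩
    rw [e.finrank_eq, h0, finrank_span_singleton (by simp [word])]
    have : {S | Δ S ∧ S.card = 0} = {∅} := by
      ext S
      simp only [Set.mem_ofPred_eq, Finset.card_eq_zero, Set.mem_singleton_iff]
      exact ⟨fun h => h.2, fun h => ⟨h ▸ he, h⟩⟩
    rw [this, Set.ncard_singleton]
  · have h0 : cyc F Δ p = ⊥ := by
      refine le_bot_iff.1 (inf_le_left.trans (chains_le fun w hv hl hΔ => (hp ?_).elim))
      obtain rfl := hw w hv hΔ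
      exact ⟨hl.symm, hΔ⟩
    have hs : Subsingleton (cyc F Δ p) := by
      rw [h0]; infer_instance
    have : Subsingleton (Homology F Δ p) := (Submodule.mkQ_surjective _).subsingleton
    refine ⟨inferInstance, ?_⟩
    rw [Module.finrank_zero_of_subsingleton]
    symm
    convert Set.ncard_empty (Finset V)
    ext S
    simp only [Set.mem_ofPred_eq, Set.mem_empty_iff_false, iff_false]
    rintro ⟨hS, hc⟩
    have := Finset.subset_empty.1 (h S hS)
    subst this
    exact hp ⟨hc.symm, hS⟩

/-- The homology of the complex of words in the faces of `Δ` counts the faces. -/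
theorem finrank_homology (X : Finset V) (hX : ∀ S, Δ S → S ⊆ X) :
    Module.Finite F (Homology F Δ p) ∧
      Module.finrank F (Homology F Δ p) = {S | Δ S ∧ S.card = p}.ncard := by
  induction X using Finset.induction_on generalizing Δ p with
  | empty => exact finrank_homology_of_subset_empty hX
  | insert x X hx ih =>
    have hfin : {S | Δ S}.Finite := (insert x X).powerset.finite_toSet.subset fun S hS =>
      Finset.mem_coe.2 (Finset.mem_powerset.2 (hX S hS))
    have hdel : ∀ q, _ := fun q => ih (Δ := deletion Δ x) (p := q)
      (fun S T h hT => ⟨fun h' => hT.1 (h h'), hΔ _ _ h hT.2⟩)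
      fun S hS => (Finset.subset_insert_iff_of_notMem hS.1).1 (hX S hS.2)
    have hlk : ∀ q, _ := fun q => ih (Δ := link Δ x) (p := q)
      (fun S T h hT => ⟨fun h' => hT.1 (h h'), hΔ _ _ (Finset.insert_subset_insert x h) hT.2⟩)
      fun S hS => (Finset.subset_insert_iff_of_notMem hS.1).1
        ((Finset.subset_insert x S).trans (hX _ hS.2))
    cases p with
    | zero =>
      obtain ⟨e⟩ := homology_zero_equiv (F := F) hΔ x
      -- `Module.finrank_prod` needs both factors finite, which is why finiteness is part of the
      -- induction.
      have := (hdel 0).1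
      refine ⟨Module.Finite.equiv e, ?_⟩
      rw [← e.finrank_eq, Module.finrank_prod, (hdel 0).2, ncard_faces_zero (Δ := Δ) x,
        Module.finrank_zero_of_subsingleton (M := Subquotient _ _), add_zero]
    | succ p =>
      obtain ⟨e⟩ := homology_succ_equiv (F := F) hΔ x (p := p)
      have := (hdel (p + 1)).1
      have := (hlk p).1
      refine ⟨Module.Finite.equiv e, ?_⟩
      rw [← e.finrank_eq, Module.finrank_prod, (hdel _).2, (hlk _).2, ncard_faces_succ x hfin]

end Words

/-! ### Subquotients under an injective map. -/

section Subquotient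

variable {F : Type*} [Field F] {M N : Type*} [AddCommGroup M] [Module F M] [AddCommGroup N]
  [Module F N]

theorem finrank_subquotient_map {T : M →ₗ[F] N} (hT : Function.Injective T)
    (Z B : Submodule F M) :
    Module.finrank F (Subquotient (Z.map T) (B.map T)) = Module.finrank F (Subquotient Z B) := by
  refine (Submodule.Quotient.equiv _ _ (Submodule.equivMapOfInjective T hT Z) ?_).finrank_eq.symm
  ext ⟨y, hy⟩
  obtain ⟨z, hz, rfl⟩ := hy
  rw [mem_submoduleOf_iff, Submodule.mem_map, Submodule.mem_map]
  constructor
  · rintro ⟨b, hb, h⟩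
    exact ⟨b, hb, congrArg Subtype.val h⟩
  · rintro ⟨b, hb, h⟩
    obtain rfl := hT h
    exact ⟨⟨b, hz⟩, hb, rfl⟩

end Subquotient

/-! ### The boundary of a word as an explicit signed sum. -/

namespace Words

variable {F : Type*} [Field F] {V : Type*} [DecidableEq V]

/-- Merge the letters with indices `i` and `i + 1`. -/
def mergeAt : ℕ → List (Finset V) → List (Finset V)
  | 0, B :: C :: w => (B ∪ C) :: w
  | i + 1, B :: w => B :: mergeAt i w
  | _, w => w

theorem mergeSum_word {p : ℕ} {w : List (Finset V)} (hp : w.length = p + 1) :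
    mergeSum (word F w) =
      ∑ i ∈ Finset.range p, (-1 : F) ^ (i + 1) • word F (mergeAt i w) +
        (-1 : F) ^ (p + 1) • word F w.dropLast := by
  induction w generalizing p with
  | nil => simp at hp
  | cons B w ih =>
    cases w with
    | nil =>
      obtain rfl : p = 0 := by simpa using hp
      simp
    | cons C w =>
      obtain ⟨p, rfl⟩ : ∃ q, p = q + 1 := ⟨w.length, by simpa using hp.symm⟩
      rw [word_cons, mergeSum_cons, ih (by simpa using hp), Finset.sum_range_succ']
      simp only [mergeAt, word_cons, absorb_cons, map_add, map_neg, map_sum, map_smul,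
        List.dropLast_cons_cons, pow_succ, mul_neg, mul_one, neg_smul, Finset.sum_neg_distrib,
        neg_neg, pow_zero, one_smul]
      abel

theorem mergeAt_map_range {k p : ℕ} (hk : k < p) {G G' : ℕ → Finset V}
    (h₁ : ∀ i < k, G' i = G i) (h₂ : G' k = G k ∪ G (k + 1)) (h₃ : ∀ i, k < i → G' i = G (i + 1)) :
    mergeAt k ((List.range (p + 1)).map G) = (List.range p).map G' := by
  induction k generalizing p G G' with
  | zero =>
    obtain ⟨p, rfl⟩ : ∃ q, p = q + 1 := ⟨p - 1, by omega⟩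
    simp only [List.range_succ_eq_map, List.map_cons, List.map_map, mergeAt, h₂]
    congr 1
    exact List.map_congr_left fun i _ => (h₃ _ (Nat.succ_pos i)).symm
  | succ k ih =>
    obtain ⟨p, rfl⟩ : ∃ q, p = q + 1 := ⟨p - 1, by omega⟩
    have e : ∀ (G : ℕ → Finset V) (q : ℕ),
        (List.range (q + 1)).map G = G 0 :: (List.range q).map (G ∘ Nat.succ) := fun G q => by
      rw [List.range_succ_eq_map, List.map_cons, List.map_map]
    rw [e G, e G', mergeAt, h₁ 0 (Nat.succ_pos k)]
    congr 1
    exact ih (by omega) (fun i hi => h₁ _ (by omega)) h₂ fun i hi => h₃ _ (by omega)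

end Words

open Words

/-! ### From cyclic partitions to words. -/

section Transfer

variable {F : Type*} [Field F] {n : ℕ} {H : Hypergraph (Fin n)} (c : Fin n)

/-- The blocks of an ordered partition after the one that contains `c`, in cyclic order. -/
def blocks {p : ℕ} (f : Fin n → Fin (p + 1)) : List (Finset (Fin n)) :=
  (List.range p).map fun i => Finset.univ.filter fun v => f v = f c + Fin.ofNat (p + 1) (i + 1)

variable {c}

theorem blocks_of_eq_zero {p : ℕ} {f : Fin n → Fin (p + 1)} (h : f c = 0) :
    blocks c f = (List.range p).map fun i => Finset.univ.filter fun v => (f v : ℕ) = i + 1 := by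
  refine List.map_congr_left fun i hi => ?_
  ext v
  rw [List.mem_range] at hi
  simp [h, Fin.ext_iff, Nat.mod_eq_of_lt (show i + 1 < p + 1 by omega)]

/-- The forgotten block is the complement of the listed ones. -/
theorem blocks_injective {p : ℕ} {f g : Fin n → Fin (p + 1)} (hf : f c = 0) (hg : g c = 0)
    (h : blocks c f = blocks c g) : f = g := by
  rw [blocks_of_eq_zero hf, blocks_of_eq_zero hg, List.map_inj_left] at h
  have key : ∀ i < p, ∀ v, (f v : ℕ) = i + 1 ↔ (g v : ℕ) = i + 1 := fun i hi v => by
    simpa using Finset.ext_iff.1 (h i (List.mem_range.2 hi)) v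
  funext v
  have hf' := (f v).isLt
  have hg' := (g v).isLt
  refine Fin.ext ?_
  by_cases h0 : (f v : ℕ) = 0
  · by_contra hne
    have := (key ((g v : ℕ) - 1) (by omega) v).2 (by omega)
    omega
  · have := (key ((f v : ℕ) - 1) (by omega) v).1 (by omega)
    omega

theorem rotIdx_add_one {p : ℕ} (j : Fin (p + 1)) : rotIdx j + 1 = j := by
  refine Fin.ext ?_
  rw [Fin.val_add_one]
  have hj := j.isLt
  simp only [rotIdx, Fin.ext_iff, Fin.val_last]
  split_ifs <;> omega

/-- `rotIdx` subtracts one modulo `p + 1`, so positions relative to the block of `c` do not change.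
-/
theorem blocks_rot {p : ℕ} (f : Fin n → Fin (p + 1)) : blocks c (rotIdx ∘ f) = blocks c f := by
  refine List.map_congr_left fun i _ => ?_
  ext v
  simp only [Finset.mem_filter, Finset.mem_univ, true_and, Function.comp_apply]
  rw [← add_left_inj (1 : Fin (p + 1)), add_right_comm, rotIdx_add_one, rotIdx_add_one]

variable (F H c) in
/-- The word of an ordered partition, with the sign that makes it invariant under the signed cyclic
shift. -/
def preToWords (p : ℕ) : PreChain F H p →ₗ[F] (List (Finset (Fin n)) →₀ F) :=
  Finsupp.linearCombination F fun B : OrdPart H (p + 1) =>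
    (-1 : F) ^ (p * (B.1 c : ℕ)) • word F (blocks c B.1)

variable (F H c) in
theorem cyclicRel_le_ker (p : ℕ) : cyclicRel F H p ≤ LinearMap.ker (preToWords F H c p) := by
  refine Submodule.span_le.2 ?_
  rintro _ ⟨B, rfl⟩
  simp only [SetLike.mem_coe, LinearMap.mem_ker, map_sub, map_smul, preToWords,
    Finsupp.linearCombination_single, one_smul]
  have hb : blocks c B.rot.1 = blocks c B.1 := blocks_rot B.1
  rw [hb, smul_smul, ← sub_smul]
  convert zero_smul F _
  rw [sub_eq_zero]
  have hr : ((B.rot.1 c : Fin (p + 1)) : ℕ) = if (B.1 c : ℕ) = 0 then p else B.1 c - 1 := rfl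
  rw [hr, ← pow_add]
  -- From block `0`, the vertex `c` moves to block `p`, and the exponent `p + p * p` is even.
  -- Otherwise its index drops by one, which offsets the sign `(-1) ^ p` of the relation.
  split_ifs with h
  · rw [h, mul_zero, pow_zero, ← mul_one_add, Even.neg_one_pow]
    rw [add_comm]
    exact Nat.even_mul_succ_self p
  · rw [← mul_one_add]
    congr 2
    omega

variable (F H c) in
/-- The words of chains. -/
def toWords (p : ℕ) : Chain F H p →ₗ[F] (List (Finset (Fin n)) →₀ F) :=
  (cyclicRel F H p).liftQ (preToWords F H c p) (cyclicRel_le_ker F H c p)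

/-- The class of an ordered partition. -/
def OrdPart.cls (F : Type*) [Field F] {p : ℕ} (B : OrdPart H (p + 1)) : Chain F H p :=
  Submodule.Quotient.mk (Finsupp.single B 1)

theorem cls_rot {p : ℕ} (B : OrdPart H (p + 1)) : B.cls F = (-1 : F) ^ p • B.rot.cls F := by
  rw [OrdPart.cls, OrdPart.cls, ← Submodule.Quotient.mk_smul, Submodule.Quotient.eq]
  exact Submodule.subset_span ⟨B, rfl⟩

theorem toWords_cls {p : ℕ} {B : OrdPart H (p + 1)} (h : B.1 c = 0) :
    toWords F H c p (B.cls F) = word F (blocks c B.1) := by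
  rw [toWords, OrdPart.cls]
  refine (Submodule.liftQ_apply _ _ _).trans ?_
  simp [preToWords, h]

variable (F H c) in
-- Each rotation lowers the index of the block of `c` by one and changes the class only by a sign.
theorem span_cls (p : ℕ) :
    Submodule.span F ((fun B : OrdPart H (p + 1) => B.cls F) '' {B | B.1 c = 0}) = ⊤ := by
  set N := Submodule.span F ((fun B : OrdPart H (p + 1) => B.cls F) '' {B | B.1 c = 0})
  have key : ∀ m : ℕ, ∀ B : OrdPart H (p + 1), (B.1 c : ℕ) = m → B.cls F ∈ N := by
    intro m
    induction m with
    | zero => exact fun B h => Submodule.subset_span ⟨B, Fin.ext h, rfl⟩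
    | succ m ih =>
      intro B h
      rw [cls_rot]
      refine Submodule.smul_mem _ _ (ih _ ?_)
      change (if (B.1 c : ℕ) = 0 then p else B.1 c - 1) = m
      rw [if_neg (by omega), h, Nat.add_sub_cancel]
  refine eq_top_iff.2 fun x hx => ?_
  clear hx
  induction x using Submodule.Quotient.induction_on with | _ x
  induction x using Finsupp.induction_linear with
  | zero => exact N.zero_mem
  | add x y hx hy =>
    rw [Submodule.Quotient.mk_add]
    exact N.add_mem hx hy
  | single B a =>
    have : Finsupp.single B a = a • Finsupp.single B (1 : F) := by simp
    rw [this, Submodule.Quotient.mk_smul]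
    exact N.smul_mem a (key _ B rfl)

theorem boundary_cls {p : ℕ} (B : OrdPart H (p + 2)) :
    boundary F H p (B.cls F) = (∑ i : Fin (p + 1), (-1 : F) ^ (i : ℕ) • (B.merge i).cls F)
      + (-1 : F) ^ (p + 1) • B.wrap.cls F := by
  rw [boundary, OrdPart.cls]
  refine (Submodule.mapQ_apply _ _ _ _).trans ?_
  rw [preBoundary, Finsupp.linearCombination_single, one_smul]
  simp only [Submodule.Quotient.mk_add, Submodule.Quotient.mk_smul, OrdPart.cls]
  congr 1
  rw [← Submodule.mkQ_apply, map_sum]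
  rfl

theorem blocks_merge_zero {p : ℕ} {B : OrdPart H (p + 2)} (h : B.1 c = 0) :
    blocks c (B.merge 0).1 = (blocks c B.1).tail := by
  have h' : (B.merge 0).1 c = 0 := by
    change mergeIdx 0 (B.1 c) = 0
    rw [h]; rfl
  rw [blocks_of_eq_zero h, blocks_of_eq_zero h', List.range_succ_eq_map, List.map_cons,
    List.tail_cons, List.map_map]
  refine List.map_congr_left fun i _ => ?_
  ext v
  have : ((B.merge 0).1 v : ℕ) = if (B.1 v : ℕ) ≤ 0 then (B.1 v : ℕ) else B.1 v - 1 := rfl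
  simp only [Finset.mem_filter, Finset.mem_univ, true_and, this, Function.comp_apply,
    Nat.succ_eq_add_one]
  split_ifs <;> omega

theorem blocks_merge_succ {p : ℕ} {B : OrdPart H (p + 2)} (h : B.1 c = 0) (i : Fin p) :
    blocks c (B.merge i.succ).1 = mergeAt i (blocks c B.1) := by
  have h' : (B.merge i.succ).1 c = 0 := by
    change mergeIdx i.succ (B.1 c) = 0
    rw [h]; rfl
  have hv : ∀ v, ((B.merge i.succ).1 v : ℕ) =
      if (B.1 v : ℕ) ≤ i + 1 then (B.1 v : ℕ) else B.1 v - 1 := fun v => rfl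
  rw [blocks_of_eq_zero h, blocks_of_eq_zero h']
  refine (mergeAt_map_range i.isLt (fun j hj => ?_) ?_ fun j hj => ?_).symm <;> ext v <;>
    simp only [Finset.mem_filter, Finset.mem_univ, true_and, hv, Finset.mem_union] <;>
    split_ifs <;> omega

theorem blocks_wrap {p : ℕ} {B : OrdPart H (p + 2)} (h : B.1 c = 0) :
    blocks c B.wrap.1 = (blocks c B.1).dropLast := by
  have hv : ∀ v, (B.wrap.1 v : ℕ) = if (B.1 v : ℕ) = p + 1 then 0 else (B.1 v : ℕ) := fun v => rfl
  have h' : B.wrap.1 c = 0 := Fin.ext (by rw [hv, h]; simp)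
  rw [blocks_of_eq_zero h, blocks_of_eq_zero h', List.range_succ, List.map_append,
    List.map_singleton, List.dropLast_concat]
  refine List.map_congr_left fun i hi => ?_
  rw [List.mem_range] at hi
  ext v
  simp only [Finset.mem_filter, Finset.mem_univ, true_and, hv]
  split_ifs
  · rw [false_iff]
    omega
  · rfl

theorem length_blocks {p : ℕ} (f : Fin n → Fin (p + 1)) : (blocks c f).length = p := by
  simp [blocks]

/-- It suffices to treat partitions with `c` in block `0`. All their mergers keep `c` there, so no
extra signs arise: merger `0` drops the first letter, `wrap` drops the last, and merger `i + 1`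
merges letters `i` and `i + 1`. -/
theorem toWords_boundary {p : ℕ} (x : Chain F H (p + 1)) :
    toWords F H c p (boundary F H p x) = bdry (toWords F H c (p + 1) x) := by
  have hx : x ∈ Submodule.span F
      ((fun B : OrdPart H (p + 2) => B.cls F) '' {B | B.1 c = 0}) := by
    rw [span_cls]; trivial
  induction hx using Submodule.span_induction with
  | zero => simp only [map_zero]
  | add x y _ _ hx hy => simp only [map_add, hx, hy]
  | smul a x _ hx => simp only [map_smul, hx]
  | mem x hx =>
    obtain ⟨B, hB, rfl⟩ := hx
    have hB : B.1 c = 0 := hB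
    have hm : ∀ i, (B.merge i).1 c = 0 := fun i => by
      change mergeIdx i (B.1 c) = 0
      rw [hB]; rfl
    have hw : B.wrap.1 c = 0 := by
      change wrapIdx (B.1 c) = 0
      rw [hB]; rfl
    change toWords F H c p (boundary F H p (B.cls F)) = bdry (toWords F H c (p + 1) (B.cls F))
    rw [boundary_cls, map_add, map_sum, toWords_cls hB]
    simp only [map_smul, toWords_cls (hm _), toWords_cls hw]
    rw [bdry, LinearMap.add_apply, mergeSum_word (length_blocks B.1), Fin.sum_univ_succ,
      blocks_wrap hB, blocks_merge_zero hB, Finset.sum_range]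
    simp only [blocks_merge_succ hB, Fin.val_zero, pow_zero, one_smul, Fin.val_succ]
    rw [add_assoc]
    congr 1
    have hl := length_blocks (c := c) B.1
    cases hb : blocks c B.1 with
    | nil => simp [hb] at hl
    | cons C w => simp

/-- The sets that miss some hyperedge. -/
def MissesEdge (H : Hypergraph (Fin n)) (S : Finset (Fin n)) : Prop :=
  ∃ e ∈ H.edgeSet, ∀ v ∈ S, v ∉ e

theorem missesEdge_mono {S T : Finset (Fin n)} (h : S ⊆ T) (hT : MissesEdge H T) :
    MissesEdge H S := by
  obtain ⟨e, he, h'⟩ := hT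
  exact ⟨e, he, fun v hv => h' v (h hv)⟩

theorem blocks_valid {p : ℕ} {B : OrdPart H (p + 1)} (h : B.1 c = 0) : Valid (blocks c B.1) := by
  rw [blocks_of_eq_zero h]
  constructor
  · intro C hC
    obtain ⟨i, hi, rfl⟩ := List.mem_map.1 hC
    rw [List.mem_range] at hi
    obtain ⟨v, hv⟩ := B.2.1 ⟨i + 1, by omega⟩
    exact ⟨v, by simp [hv]⟩
  · rw [List.pairwise_map]
    refine List.pairwise_lt_range.imp fun hij => ?_
    rw [Finset.disjoint_left]
    intro v hv hv'
    simp only [Finset.mem_filter, Finset.mem_univ, true_and] at hv hv'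
    omega

/-- A block that contains a hyperedge contains `c`, hence is the forgotten block `0`, disjoint from
all letters. -/
theorem blocks_missesEdge (hc : ∀ e ∈ H.edgeSet, c ∈ e) {p : ℕ} {B : OrdPart H (p + 1)}
    (h : B.1 c = 0) : MissesEdge H (union (blocks c B.1)) := by
  obtain ⟨j, e, he, hj⟩ := B.2.2
  have hj0 : B.1 c = j := hj (hc e he)
  refine ⟨e, he, fun v hv hve => ?_⟩
  have hvj : B.1 v = j := hj hve
  rw [mem_union_iff, blocks_of_eq_zero h] at hv
  obtain ⟨C, hC, hv⟩ := hv
  obtain ⟨i, hi, rfl⟩ := List.mem_map.1 hC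
  simp only [Finset.mem_filter, Finset.mem_univ, true_and] at hv
  rw [hvj, ← hj0, h] at hv
  simp at hv

/-- Block `0` is taken to be the complement of the union; it contains the missed hyperedge, and `c`
with it. -/
theorem exists_blocks_eq (hc : ∀ e ∈ H.edgeSet, c ∈ e) {w : List (Finset (Fin n))} (hw : Valid w)
    (hm : MissesEdge H (union w)) :
    ∃ B : OrdPart H (w.length + 1), B.1 c = 0 ∧ blocks c B.1 = w := by
  have hcw : c ∉ union w := by
    obtain ⟨e, he, h⟩ := hm
    exact fun h' => h c h' (hc e he)
  let f : Fin n → Fin (w.length + 1) := fun v =>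
    if h : v ∈ union w then
      ⟨w.findIdx (fun C => v ∈ C) + 1, by
        have : w.findIdx (fun C => decide (v ∈ C)) < w.length := by
          rw [List.findIdx_lt_length]
          simpa using mem_union_iff.1 h
        omega⟩
    else 0
  have hf : ∀ (v : Fin n) (i : ℕ) (hi : i < w.length), (f v : ℕ) = i + 1 ↔ v ∈ w[i] := by
    intro v i hi
    by_cases hv : v ∈ union w
    · simp only [f, hv, dif_pos, Nat.add_right_cancel_iff]
      rw [List.findIdx_eq hi]
      constructor
      · exact fun h => by simpa using h.1
      · intro h
        refine ⟨by simpa using h, fun j hj => ?_⟩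
        have := List.pairwise_iff_getElem.1 hw.2 j i (by omega) hi hj
        simpa using Finset.disjoint_right.1 this h
    · have : v ∉ w[i] := fun h => hv (mem_union_iff.2 ⟨_, List.getElem_mem hi, h⟩)
      simp [f, hv, this]
  have hf0 : ∀ v ∉ union w, f v = 0 := fun v hv => by simp [f, hv]
  refine ⟨⟨f, fun j => ?_, ?_⟩, hf0 c hcw, ?_⟩
  · by_cases hj : (j : ℕ) = 0
    · exact ⟨c, by rw [hf0 c hcw]; exact Fin.ext hj.symm⟩
    · have hj' : (j : ℕ) - 1 < w.length := by omega
      obtain ⟨v, hv⟩ := hw.1 _ (List.getElem_mem hj')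
      exact ⟨v, Fin.ext (((hf v _ hj').2 hv).trans (by omega))⟩
  · obtain ⟨e, he, h⟩ := hm
    exact ⟨0, e, he, fun v hv => hf0 v fun h' => h v h' hv⟩
  · rw [blocks_of_eq_zero (hf0 c hcw)]
    refine List.ext_getElem (by simp) fun i h₁ h₂ => ?_
    ext v
    simp [hf v i h₂]

/-- The spanning classes with `c` in block `0` go to distinct words, which are basis vectors. -/
theorem toWords_injective {p : ℕ} : Function.Injective (toWords F H c p) := by
  rw [injective_iff_map_eq_zero]
  intro x hx
  have hmem : x ∈ Submodule.span F
      ((fun B : OrdPart H (p + 1) => B.cls F) '' {B | B.1 c = 0}) := by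
    rw [span_cls]; trivial
  obtain ⟨l, hl, rfl⟩ := (Finsupp.mem_span_image_iff_linearCombination F).1 hmem
  have h : Finsupp.mapDomain (fun B : OrdPart H (p + 1) => blocks c B.1) l = 0 := by
    rw [← hx, Finsupp.linearCombination_apply, map_finsuppSum, Finsupp.mapDomain]
    refine Finsupp.sum_congr fun B hB => ?_
    rw [map_smul, toWords_cls ((Finsupp.mem_supported _ _).1 hl hB), word]
    simp
  have h0 : l = 0 := by
    refine Finsupp.mapDomain_injOn {B : OrdPart H (p + 1) | B.1 c = 0}
      (f := fun B : OrdPart H (p + 1) => blocks c B.1)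
      ?_ (x₁ := l) hl (x₂ := 0) (by simp) (h.trans Finsupp.mapDomain_zero.symm)
    exact fun B hB B' hB' h => Subtype.ext (blocks_injective hB hB' h)
  rw [h0, map_zero]

theorem range_toWords (hc : ∀ e ∈ H.edgeSet, c ∈ e) (p : ℕ) :
    LinearMap.range (toWords F H c p) = chains F (MissesEdge H) p := by
  refine le_antisymm ?_ (chains_le fun w hw hp hm => ?_)
  · rw [LinearMap.range_eq_map, ← span_cls F H c, Submodule.map_span, Submodule.span_le]
    rintro _ ⟨_, ⟨B, hB, rfl⟩, rfl⟩
    have hB : B.1 c = 0 := hB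
    change toWords F H c p (B.cls F) ∈ _
    rw [toWords_cls hB]
    exact word_mem (blocks_valid hB) (length_blocks _) (blocks_missesEdge hc hB)
  · subst hp
    obtain ⟨B, hB, h⟩ := exists_blocks_eq hc hw hm
    exact ⟨B.cls F, by rw [toWords_cls hB, h]⟩

theorem map_cycles (hc : ∀ e ∈ H.edgeSet, c ∈ e) (p : ℕ) :
    (cycles F H p).map (toWords F H c p) = cyc F (MissesEdge H) p := by
  ext z
  rw [mem_cyc, ← range_toWords hc, LinearMap.mem_range, Submodule.mem_map]
  cases p with
  | zero =>
    constructor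
    · rintro ⟨x, -, rfl⟩
      refine ⟨⟨x, rfl⟩, bdry_eq_zero (Δ := MissesEdge H) ?_⟩
      rw [← range_toWords hc]
      exact ⟨x, rfl⟩
    · rintro ⟨⟨x, rfl⟩, -⟩
      exact ⟨x, Submodule.mem_top, rfl⟩
  | succ p =>
    constructor
    · rintro ⟨x, hx, rfl⟩
      refine ⟨⟨x, rfl⟩, ?_⟩
      rw [← toWords_boundary, LinearMap.mem_ker.1 hx, map_zero]
    · rintro ⟨⟨x, rfl⟩, hx⟩
      refine ⟨x, LinearMap.mem_ker.2 (toWords_injective (c := c) ?_), rfl⟩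
      rw [toWords_boundary, hx, map_zero]

theorem map_range_boundary (hc : ∀ e ∈ H.edgeSet, c ∈ e) (p : ℕ) :
    (LinearMap.range (boundary F H p)).map (toWords F H c p) = bds F (MissesEdge H) p := by
  ext z
  rw [mem_bds, ← range_toWords hc, Submodule.mem_map]
  constructor
  · rintro ⟨_, ⟨x, rfl⟩, rfl⟩
    exact ⟨_, ⟨x, rfl⟩, (toWords_boundary x).symm⟩
  · rintro ⟨_, ⟨x, rfl⟩, rfl⟩
    exact ⟨_, ⟨x, rfl⟩, toWords_boundary x⟩

/-- If the hyperedges share a vertex, then the homology of the cyclic coloring complex counts the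
sets of vertices that miss some hyperedge. -/
theorem finrank_HC (hc : ∀ e ∈ H.edgeSet, c ∈ e) (p : ℕ) :
    Module.finrank F (HC F H p) = {S | MissesEdge H S ∧ S.card = p}.ncard := by
  rw [← (finrank_homology (F := F) (Δ := MissesEdge H) (fun _ _ => missesEdge_mono)
    Finset.univ fun S _ => Finset.subset_univ S).2]
  change _ = Module.finrank F (Subquotient _ _)
  rw [← map_cycles hc p,
    ← map_range_boundary hc p, finrank_subquotient_map toWords_injective]

end Transfer

/-! ### Counting the sets that miss a run. -/

section Count

variable {n : ℕ}

/-- The sets that miss some run of `k` consecutive vertices. -/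
def MissesRun (k : ℕ) (S : Finset (Fin n)) : Prop :=
  ∃ i : ℕ, i + k ≤ n ∧ ∀ v ∈ S, (v : ℕ) < i ∨ i + k ≤ v

theorem mem_edgeSet_image_iff {k : ℕ} {σ : Equiv.Perm (Fin n)} {e : Set (Fin n)} :
    e ∈ ((diagonalHypergraph n k).image σ).edgeSet ↔
      ∃ i : ℕ, i + k ≤ n ∧ σ '' {v : Fin n | i ≤ (v : ℕ) ∧ (v : ℕ) < i + k} = e := by
  rw [Hypergraph.mem_edgeSet_image]
  constructor
  · rintro ⟨_, ⟨i, hi, rfl⟩, rfl⟩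
    exact ⟨i, hi, rfl⟩
  · rintro ⟨i, hi, rfl⟩
    exact ⟨_, ⟨i, hi, rfl⟩, rfl⟩

theorem missesEdge_image_iff {k : ℕ} {σ : Equiv.Perm (Fin n)} {S : Finset (Fin n)} :
    MissesEdge ((diagonalHypergraph n k).image σ) (S.map σ.toEmbedding) ↔ MissesRun k S := by
  constructor
  · rintro ⟨e, he, h⟩
    obtain ⟨i, hi, rfl⟩ := mem_edgeSet_image_iff.1 he
    refine ⟨i, hi, fun v hv => ?_⟩
    by_contra hn
    exact h (σ v) (Finset.mem_map_of_mem σ.toEmbedding hv) ⟨v, by constructor <;> omega, rfl⟩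
  · rintro ⟨i, hi, h⟩
    refine ⟨_, mem_edgeSet_image_iff.2 ⟨i, hi, rfl⟩, fun u hu => ?_⟩
    obtain ⟨v, hv, rfl⟩ := Finset.mem_map.1 hu
    rintro ⟨v', ⟨h1, h2⟩, hv'⟩
    obtain rfl := σ.injective hv'
    have := h v' hv
    omega

theorem ncard_missesEdge_image (k p : ℕ) (σ : Equiv.Perm (Fin n)) :
    {S | MissesEdge ((diagonalHypergraph n k).image σ) S ∧ S.card = p}.ncard =
      {S : Finset (Fin n) | MissesRun k S ∧ S.card = p}.ncard := by
  rw [← Set.ncard_image_of_injective {S : Finset (Fin n) | MissesRun k S ∧ S.card = p}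
    (Finset.map_injective σ.toEmbedding)]
  congr 1
  ext S
  constructor
  · rintro ⟨h, hc⟩
    have hS : (S.map σ.symm.toEmbedding).map σ.toEmbedding = S := by
      ext v; simp
    exact ⟨S.map σ.symm.toEmbedding, ⟨missesEdge_image_iff.1 (hS.symm ▸ h), by simpa using hc⟩, hS⟩
  · rintro ⟨T, ⟨h, hc⟩, rfl⟩
    exact ⟨missesEdge_image_iff.2 h, by simpa using hc⟩

theorem card_filter_le {k : ℕ} (hk : k < n) :
    (Finset.univ.filter fun v : Fin n => k ≤ (v : ℕ)).card = n - k := by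
  have : (Finset.univ.filter fun v : Fin n => k ≤ (v : ℕ)) = Finset.Ici ⟨k, hk⟩ := by
    ext v; simp [Fin.le_def]
  rw [this, Fin.card_Ici]

/-- These are the vertices still available once `a` is the greatest element to the left of the run
`a + 1, …, a + k`. -/
theorem card_filter_lt_or_le {a k : ℕ} (h : a + k < n) :
    (Finset.univ.filter fun v : Fin n => (v : ℕ) < a ∨ a + 1 + k ≤ v).card = n - k - 1 := by
  have : (Finset.univ.filter fun v : Fin n => (v : ℕ) < a ∨ a + 1 + k ≤ v) =
      (Finset.Icc (⟨a, by omega⟩ : Fin n) ⟨a + k, h⟩)ᶜ := by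
    ext v
    simp only [Finset.mem_filter, Finset.mem_univ, true_and, Finset.mem_compl, Finset.mem_Icc,
      Fin.le_def]
    omega
  rw [this, Finset.card_compl, Fin.card_Icc, Fintype.card_fin]
  dsimp only
  omega

theorem card_filter_lt {m : ℕ} (h : m < n) :
    (Finset.univ.filter fun v : Fin n => (v : ℕ) < m).card = m := by
  have : (Finset.univ.filter fun v : Fin n => (v : ℕ) < m) = Finset.Iio ⟨m, h⟩ := by
    ext v; simp [Fin.lt_def]
  rw [this, Fin.card_Iio]

/-- The sets with `p + 1` elements that miss a run, sorted by their greatest element on the left of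
the run. -/
theorem missesRun_iff {k p : ℕ} {S : Finset (Fin n)} (hkn : k < n) :
    MissesRun k S ∧ S.card = p + 1 ↔
      S ∈ (Finset.univ.filter fun v : Fin n => k ≤ (v : ℕ)).powersetCard (p + 1) ∪
        (Finset.univ.filter fun a : Fin n => (a : ℕ) < n - k).biUnion fun a =>
          ((Finset.univ.filter fun v : Fin n => (v : ℕ) < a ∨ a + 1 + k ≤ (v : ℕ)).powersetCard
            p).image (insert a) := by
  simp only [Finset.mem_union, Finset.mem_powersetCard, Finset.mem_biUnion, Finset.mem_image,
    Finset.mem_filter, Finset.mem_univ, true_and, Finset.subset_iff]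
  constructor
  · rintro ⟨⟨i, hi, h⟩, hc⟩
    rcases (S.filter fun v : Fin n => (v : ℕ) < i).eq_empty_or_nonempty with he | hne
    · refine Or.inl ⟨fun v hv => ?_, hc⟩
      have h1 : ¬ (v : ℕ) < i := fun h' => by
        have : v ∈ S.filter fun v : Fin n => (v : ℕ) < i := Finset.mem_filter.2 ⟨hv, h'⟩
        simp [he] at this
      have := h v hv
      omega
    · right
      set a := (S.filter fun v : Fin n => (v : ℕ) < i).max' hne
      obtain ⟨haS, hai⟩ := Finset.mem_filter.1 (Finset.max'_mem _ hne)
      refine ⟨a, by omega, S.erase a, ⟨fun v hv => ?_, ?_⟩, Finset.insert_erase haS⟩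
      · obtain ⟨hva, hvS⟩ := Finset.mem_erase.1 hv
        rcases h v hvS with h' | h'
        · have hle : v ≤ a := Finset.le_max' _ v (Finset.mem_filter.2 ⟨hvS, h'⟩)
          exact Or.inl (Fin.lt_def.1 (lt_of_le_of_ne hle hva))
        · exact Or.inr (by omega)
      · rw [Finset.card_erase_of_mem haS, hc, Nat.add_sub_cancel]
  · rintro (⟨h, hc⟩ | ⟨a, ha, T, ⟨h, hc⟩, rfl⟩)
    · exact ⟨⟨0, by omega, fun v hv => Or.inr (by have := h hv; omega)⟩, hc⟩
    · refine ⟨⟨a + 1, by omega, fun v hv => ?_⟩, ?_⟩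
      · rcases Finset.mem_insert.1 hv with rfl | hv
        · exact Or.inl (Nat.lt_succ_self _)
        · have := h hv
          omega
      · rw [Finset.card_insert_of_notMem, hc]
        intro h'
        have := h h'
        omega

/-- The classes of `missesRun_iff` are disjoint because `n - k < k`: a vertex below `n - k` cannot
lie to the right of any run, so `a` is determined by the set. -/
theorem ncard_missesRun {k : ℕ} (p : ℕ) (hkn : k < n) (hnk : n < 2 * k) :
    {S : Finset (Fin n) | MissesRun k S ∧ S.card = p + 1}.ncard =
      (n - k) * (n - k - 1).choose p + (n - k).choose (p + 1) := by
  have : {S : Finset (Fin n) | MissesRun k S ∧ S.card = p + 1} = (_ : Finset (Finset (Fin n))) :=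
    Set.ext fun S => missesRun_iff (p := p) (S := S) hkn
  rw [this, Set.ncard_coe_finset, Finset.card_union_of_disjoint, Finset.card_powersetCard,
    card_filter_le hkn, add_comm]
  · congr 1
    rw [Finset.card_biUnion]
    · rw [Finset.sum_congr rfl (g := fun _ => (n - k - 1).choose p), Finset.sum_const,
        card_filter_lt (by omega), smul_eq_mul]
      intro a ha
      rw [Finset.mem_filter] at ha
      rw [Finset.card_image_of_injOn, Finset.card_powersetCard, card_filter_lt_or_le (by omega)]
      intro T hT T' hT' h
      have hmem : ∀ T ∈ ((Finset.univ.filter fun v : Fin n =>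
          (v : ℕ) < a ∨ a + 1 + k ≤ (v : ℕ)).powersetCard p), a ∉ T := fun T hT h' => by
        have := Finset.mem_filter.1 ((Finset.mem_powersetCard.1 hT).1 h')
        omega
      rw [← Finset.erase_insert (hmem T hT), ← Finset.erase_insert (hmem T' hT')]
      exact congrArg (fun U => Finset.erase U a) h
    · intro a ha b hb hab
      have ha := (Finset.mem_filter.1 ha).2
      have hb := (Finset.mem_filter.1 hb).2
      refine Finset.disjoint_left.2 fun S hS hS' => ?_
      obtain ⟨T, hT, rfl⟩ := Finset.mem_image.1 hS
      obtain ⟨T', hT', h⟩ := Finset.mem_image.1 hS'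
      have h1 : a ∈ insert b T' := h ▸ Finset.mem_insert_self a T
      have h2 : b ∈ insert a T := h ▸ Finset.mem_insert_self b T'
      have h3 := (Finset.mem_filter.1 ((Finset.mem_powersetCard.1 hT).1
        (Finset.mem_of_mem_insert_of_ne h2 hab.symm))).2
      have h4 := (Finset.mem_filter.1 ((Finset.mem_powersetCard.1 hT').1
        (Finset.mem_of_mem_insert_of_ne h1 hab))).2
      -- Both `a` and `b` are below `n - k < k`, so `h3` and `h4` leave only `b < a` and `a < b`.
      omega
  · refine Finset.disjoint_left.2 fun S hS hS' => ?_
    obtain ⟨a, ha, hS'⟩ := Finset.mem_biUnion.1 hS'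
    obtain ⟨T, hT, rfl⟩ := Finset.mem_image.1 hS'
    have h1 := (Finset.mem_filter.1 ha).2
    have h2 := (Finset.mem_filter.1 ((Finset.mem_powersetCard.1 hS).1
      (Finset.mem_insert_self a T))).2
    omega

theorem ncard_missesRun_zero {k : ℕ} (hkn : k ≤ n) :
    {S : Finset (Fin n) | MissesRun k S ∧ S.card = 0}.ncard = 1 := by
  have : {S : Finset (Fin n) | MissesRun k S ∧ S.card = 0} = {∅} := by
    ext S
    rw [Set.mem_singleton_iff, ← Finset.card_eq_zero]
    refine ⟨fun h => h.2, fun h => ⟨⟨0, by omega, fun v hv => ?_⟩, h⟩⟩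
    rw [Finset.card_eq_zero.1 h] at hv
    exact absurd hv (Finset.notMem_empty v)
  rw [this, Set.ncard_singleton]

end Count

end CyclicColoring

end

/-- `CyclicColoring.HC F H (r + 1)` is the homology group in degree `r`, and `HC F H 0` the one in
degree `-1`. -/
theorem theorem5p3 (F : Type*) [Field F] [CharZero F] (n k : ℕ) (hkn : k ≤ n)
    (hk : ⌈(n : ℚ) / 2⌉₊ < k) (H : Hypergraph (Fin n)) (hH : CyclicColoring.IsDiagonal H k) :
    (∀ r : ℕ, r + k + 1 ≤ n →
      Module.finrank F (CyclicColoring.HC F H (r + 1)) =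
        (n - k) * (n - k - 1).choose r + (n - k).choose (r + 1)) ∧
    Module.finrank F (CyclicColoring.HC F H 0) = 1 := by
  have hnk : n < 2 * k := by
    have h1 : (n : ℚ) / 2 ≤ (⌈(n : ℚ) / 2⌉₊ : ℚ) := Nat.le_ceil _
    have h2 : ((⌈(n : ℚ) / 2⌉₊ : ℕ) : ℚ) < (k : ℚ) := Nat.cast_lt.2 hk
    have h3 : (n : ℚ) < ((2 * k : ℕ) : ℚ) := by
      push_cast
      linarith
    exact_mod_cast h3
  obtain ⟨σ, rfl⟩ := hH
  -- The first vertex of the last run lies in every run `i, …, i + k - 1`, as `i ≤ n - k < k ≤ i +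
  -- k`.
  have hc : ∀ e ∈ ((CyclicColoring.diagonalHypergraph n k).image σ).edgeSet,
      σ ⟨n - k, by omega⟩ ∈ e := by
    intro e he
    obtain ⟨i, hi, rfl⟩ := CyclicColoring.mem_edgeSet_image_iff.1 he
    exact ⟨_, ⟨by dsimp only; omega, by dsimp only; omega⟩, rfl⟩
  constructor
  · intro r hr
    rw [CyclicColoring.finrank_HC hc, CyclicColoring.ncard_missesEdge_image,
      CyclicColoring.ncard_missesRun r (by omega) hnk]
  · rw [CyclicColoring.finrank_HC hc, CyclicColoring.ncard_missesEdge_image,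
      CyclicColoring.ncard_missesRun_zero hkn]
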